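/- **Correlated Erdős–Rényi model.** For $p\ge 0$, $s\in[0,1]$ with $p(2-s)\le 1$, let $ERC(n,p,s)$ be the law of a pair $(G_1,G_2)$ of random graphs on $[n]=\{1,\dots,n\}$ such that, independently over the unordered pairs $\{i,j\}$ of distinct nodes, $\{i,j\}$ is an edge of both graphs with probability $ps$, of $G_1$ only with probability $p(1-s)$, of $G_2$ only with probability $p(1-s)$, and of neither with probability $1-p(2-s)$ (the underlying node permutation is the identity). **Matching weights.** For $d\ge 0$ and finite rooted trees $\mathcal T,\mathcal T'$, let $\mathcal W_d(\mathcal T,\mathcal T')$ be the largest number of leaves of a rooted tree $t$ all of whose leaves are at depth $d$ and which embeds in both $\mathcal T$ and $\mathcal T'$, where an embedding is an injective map of the vertices sending the root to the root and the parent of each non-root vertex to the parent of its image; $\mathcal W_d(\mathcal T,\mathcal T')=0$ if there is no such $t$. For adjacent vertices $i,j$ of a graph $G$, let $\mathcal T_d^{(j\leftarrow i)}(G)$ be the subgraph, rooted at $j$, induced by the vertices at distance at most $d$ from $j$ once the vertex $i$ has been removed from $G$. Let $\mathcal W_d(j\leftarrow i, v\leftarrow u):=\mathcal W_d\big(\mathcal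 T_d^{(j\leftarrow i)}(G_1),\mathcal T_d^{(v\leftarrow u)}(G_2)\big)$. **Algorithm (NTMA).** Given $G_1,G_2$, a depth $d\ge 1$ and a threshold $\gamma$, the Neighborhood Tree Matching Algorithm returns the set $\mathcal S$ of all pairs $(i,u)\in V(G_1)\times V(G_2)$ such that the ball of radius $d$ around $i$ in $G_1$ and the ball of radius $d$ around $u$ in $G_2$ contain no cycle, and there are distinct neighbors $j\ne j'$ of $i$ in $G_1$ and distinct neighbors $v\ne v'$ of $u$ in $G_2$ with $$\mathcal W_{d-1}(j\leftarrow i, v\leftarrow u)>\gamma^{d-1}\quad\text{and}\quad \mathcal W_{d-1}(j'\leftarrow i, v'\leftarrow u)>\gamma^{d-1}.$$ (The subgraphs that are compared are then trees.) **Theorem.** Let $s\in[0,1]$ and let $\lambda$ be a real number with $\lambda s>1$. Let $c>0$ satisfy $c\log(\lambda(2-s))<1/2$ and let $\gamma\in(1,\lambda s)$. For each $n$, let $(G_1,G_2)\sim ERC(n,\lambda/n,s)$ (which is defined for all large $n$) and let $\mathcal S$ be the output of NTMA on $(G_1,G_2)$ with depth $d=\lfloor c\log n\rfloor$ and threshold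 $\gamma$. Then there is a constant $\alpha>0$, not depending on $n$, such that $$\mathbb P\Big(\frac1n\sum_{i=1}^n \mathbf 1_{\{(i,i)\in\mathcal S\}}\ \ge\ \alpha\Big)\longrightarrow 1\qquad (n\to\infty).$$ -/

import Mathlib

open MeasureTheory

/-- A graph with a distinguished vertex. It is a rooted tree when `graph.IsTree`. -/
structure RootedGraph (V : Type*) where
  graph : SimpleGraph V
  root : V

namespace RootedGraph

/-- Depth of a vertex: its graph distance to the root. -/
noncomputable def depth {V : Type*} (T : RootedGraph V) (v : V) : ℕ :=
  T.graph.dist T.root v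

/-- `T.IsParent p v`: the vertex `p` is the parent of `v`. In a rooted tree, every vertex other
than the root has exactly one parent and the root has none. -/
def IsParent {V : Type*} (T : RootedGraph V) (p v : V) : Prop :=
  T.graph.Adj p v ∧ T.depth v = T.depth p + 1

/-- A leaf is a vertex without children. -/
def IsLeaf {V : Type*} (T : RootedGraph V) (v : V) : Prop :=
  ∀ w, ¬ T.IsParent v w

/-- The set of vertices at depth exactly `d`. -/
def level {V : Type*} (T : RootedGraph V) (d : ℕ) : Set V :=
  {v | T.depth v = d}

/-- Membership in the class of rooted trees all of whose leaves have depth `d`. -/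
def IsTreeWithLeavesAt {V : Type*} (t : RootedGraph V) (d : ℕ) : Prop :=
  t.graph.IsTree ∧ ∀ v, t.IsLeaf v → t.depth v = d

/-- Injective maps of the vertices that send root to root and the parent of each non-root vertex
to the parent of its image. -/
def IsEmbedding {U V : Type*} (t : RootedGraph U) (T : RootedGraph V) (f : U → V) : Prop :=
  Function.Injective f ∧ f t.root = T.root ∧
    ∀ p v, t.IsParent p v → T.IsParent (f p) (f v)

/-- The numbers of depth-`d` vertices of the trees that have all leaves at depth `d` and embed in
both `T` and `T'`. -/
def commonLeafCounts {V V' : Type*} (T : RootedGraph V) (T' : RootedGraph V') (d : ℕ) : Set ℕ :=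
  {k | ∃ (U : Type) (t : RootedGraph U), t.IsTreeWithLeavesAt d ∧
    (∃ f : U → V, t.IsEmbedding T f) ∧ (∃ f' : U → V', t.IsEmbedding T' f') ∧
    (t.level d).ncard = k}

/-- The matching weight of two finite rooted trees at depth `d`; it is `0` if there is no common
tree. -/
noncomputable def matchingWeight {V V' : Type*} (T : RootedGraph V) (T' : RootedGraph V')
    (d : ℕ) : ℕ :=
  sSup (T.commonLeafCounts T' d)

/-- For finite trees the supremum defining the matching weight is that of a bounded set. -/
theorem bddAbove_commonLeafCounts {V V' : Type*} [Finite V] (T : RootedGraph V)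
    (T' : RootedGraph V') (d : ℕ) : BddAbove (T.commonLeafCounts T' d) := by
  refine ⟨Nat.card V, ?_⟩
  rintro k ⟨U, t, -, ⟨f, hf, -⟩, -, rfl⟩
  have : Finite U := Finite.of_injective f hf
  exact (Set.ncard_le_card _).trans (Nat.card_le_card_of_injective f hf)

end RootedGraph

namespace SimpleGraph

/-- The vertices at distance at most `d` from `v`. -/
def closedBall {V : Type*} (G : SimpleGraph V) (v : V) (d : ℕ) : Set V :=
  {w | G.edist v w ≤ d}

/-- The ball of radius `d` around `v` contains no cycle. -/
def NoCycleInBall {V : Type*} (G : SimpleGraph V) (v : V) (d : ℕ) : Prop :=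
  (G.induce (G.closedBall v d)).IsAcyclic

/-- The vertices at distance at most `d` from `j` once the vertex `i` (a neighbor of `j`) has been
removed. As `i` is isolated in `G.deleteIncidenceSet i`, this set does not contain `i ≠ j`. -/
def branchVerts {V : Type*} (G : SimpleGraph V) (d : ℕ) (j i : V) : Set V :=
  (G.deleteIncidenceSet i).closedBall j d

/-- The graph reached from the oriented edge `i → j` up to depth `d`: it is rooted at `j`, and its
vertices are those within distance `d` of `j` after removal of `i`. It is a rooted tree if
the ball of radius `d + 1` around `i` contains no cycle. -/
def branch {V : Type*} (G : SimpleGraph V) (d : ℕ) (j i : V) :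
    RootedGraph (G.branchVerts d j i) where
  graph := G.induce (G.branchVerts d j i)
  root := ⟨j, by simp [branchVerts, closedBall]⟩

end SimpleGraph

/-- The matching weight at depth `d` of the oriented edges `i → j` of `G₁` and `u → v` of `G₂`. -/
noncomputable def edgeWeight {V₁ V₂ : Type*} (G₁ : SimpleGraph V₁) (G₂ : SimpleGraph V₂) (d : ℕ)
    (j i : V₁) (v u : V₂) : ℕ :=
  (G₁.branch d j i).matchingWeight (G₂.branch d v u) d

/-- The set of pairs returned by the Neighborhood Tree Matching Algorithm with depth `d ≥ 1` and
parameter `γ`. -/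
def ntma {V₁ V₂ : Type*} (G₁ : SimpleGraph V₁) (G₂ : SimpleGraph V₂) (d : ℕ) (γ : ℝ) :
    Set (V₁ × V₂) :=
  {(i, u) | G₁.NoCycleInBall i d ∧ G₂.NoCycleInBall u d ∧
    ∃ j ∈ G₁.neighborSet i, ∃ j' ∈ G₁.neighborSet i,
    ∃ v ∈ G₂.neighborSet u, ∃ v' ∈ G₂.neighborSet u,
      j ≠ j' ∧ v ≠ v' ∧
      γ ^ (d - 1) < (edgeWeight G₁ G₂ (d - 1) j i v u : ℝ) ∧
      γ ^ (d - 1) < (edgeWeight G₁ G₂ (d - 1) j' i v' u : ℝ)}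

/-- The joint law of the two adjacency indicators of a single pair of nodes. -/
noncomputable def pairLaw (p s : ℝ) : Measure (Bool × Bool) :=
  ENNReal.ofReal (p * s) • Measure.dirac (true, true)
    + ENNReal.ofReal (p * (1 - s)) • Measure.dirac (true, false)
    + ENNReal.ofReal (p * (1 - s)) • Measure.dirac (false, true)
    + ENNReal.ofReal (1 - p * (2 - s)) • Measure.dirac (false, false)

theorem isProbabilityMeasure_pairLaw {p s : ℝ} (hp : 0 ≤ p) (hs : s ∈ Set.Icc (0 : ℝ) 1)
    (hps : p * (2 - s) ≤ 1) : IsProbabilityMeasure (pairLaw p s) := by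
  have h0 : 0 ≤ p * s := mul_nonneg hp hs.1
  have h1 : 0 ≤ p * (1 - s) := mul_nonneg hp (by linarith [hs.2])
  have h2 : 0 ≤ 1 - p * (2 - s) := by linarith
  constructor
  simp only [pairLaw, Measure.coe_add, Measure.coe_smul, Pi.add_apply, Pi.smul_apply,
    measure_univ, smul_eq_mul, mul_one]
  rw [← ENNReal.ofReal_add h0 h1, ← ENNReal.ofReal_add (by linarith) h1,
    ← ENNReal.ofReal_add (by linarith) h2, ENNReal.ofReal_eq_one]
  ring

/-- The two graphs read off from the indicators attached to the pairs of nodes (an indicator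
attached to a degenerate pair `{i, i}` is ignored by `fromEdgeSet`). -/
def graphPair {n : ℕ} (ω : Sym2 (Fin n) → Bool × Bool) :
    SimpleGraph (Fin n) × SimpleGraph (Fin n) :=
  (SimpleGraph.fromEdgeSet {e | (ω e).1 = true}, SimpleGraph.fromEdgeSet {e | (ω e).2 = true})

theorem measurable_graphPair {n : ℕ} : Measurable (graphPair (n := n)) :=
  Measurable.of_discrete

/-- The law of a pair of correlated Erdős–Rényi graphs on `n` nodes, the underlying permutation
being the identity: the pairs of indicators are independent over the pairs of nodes. It is a
probability measure as soon as `0 ≤ p`, `0 ≤ s ≤ 1` and `p * (2 - s) ≤ 1`. -/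
noncomputable def ERC (n : ℕ) (p s : ℝ) :
    Measure (SimpleGraph (Fin n) × SimpleGraph (Fin n)) :=
  (Measure.pi fun _ : Sym2 (Fin n) => pairLaw p s).map graphPair

theorem isProbabilityMeasure_ERC {n : ℕ} {p s : ℝ} (hp : 0 ≤ p) (hs : s ∈ Set.Icc (0 : ℝ) 1)
    (hps : p * (2 - s) ≤ 1) : IsProbabilityMeasure (ERC n p s) := by
  have := isProbabilityMeasure_pairLaw hp hs hps
  exact Measure.isProbabilityMeasure_map measurable_graphPair.aemeasurable

/-! Two graphs on the same nodes control everything: the intersection `H` of the two graphs (marks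
`InBoth`, mean degree about `μ = λs > 1`) and their union `U` (marks `InEither`, mean degree about
`m = λ(2-s)`). If the ball of radius `d` around `i` in `U` has no cycle, then so it is in `G₁` and
in `G₂`, and the branches of `H` at `i` embed in those of both graphs. So `(i, i)` is returned as
soon as `i` has two neighbors in `H` whose branches, once `i` is removed, each have more than
`γ^(d-1)` vertices at distance `d - 1` (`Branching`); this is `mem_ntma`.

Acyclicity: since `c log m < 1/2`, a ball of radius `d` in `U` has second moment of order `m^(2d)`,
up to powers of `d`, which is far less than `n`. The expected number of coincidences that close a
cycle tends to `0` (`mean_excess_le`).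

Branching: `H` is supercritical, so its sphere of radius `k` has mean of order `μ^k` and second
moment of order `μ^(2k)`. The Paley–Zygmund argument then gives more than `γ^k` vertices with
probability bounded below (`le_prob_lt_size`), and a node has two such branches with probability at
least some `β > 0` (`le_prob_branching`). The moments come from recursions in the finite graph
itself, without a coupling with a Galton–Watson tree. The independence behind them is
`mean_frontier`: knowing which vertices lie at distance `k`, and which lie farther, says nothing
about the pairs among these vertices.

Concentration: resampling one pair changes the event `Branching` only at nodes close to that pair,
so the Efron–Stein inequality bounds the variance of the number of branching nodes by `o(n²)`
(`variance_sum_branching_le`). Chebyshev for branching and Markov for cycles finish the proof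
(`one_sub_le_mean_fraction`). -/

set_option linter.unusedSectionVars false

/-! ### Finite product measures and the Efron–Stein inequality. -/

/-- The expectation of `f` when the coordinates are independent with common weights `w`. -/
noncomputable def productMean {ι α : Type*} [Fintype ι] [DecidableEq ι] [Fintype α] (w : α → ℝ)
    (f : (ι → α) → ℝ) : ℝ :=
  ∑ ω, (∏ e, w (ω e)) * f ω

namespace productMean

variable {ι α : Type*} [Fintype ι] [DecidableEq ι] [Fintype α] {w : α → ℝ}

/-- The average of `f` over the coordinate `e`. -/
noncomputable def avg (w : α → ℝ) (e : ι) (f : (ι → α) → ℝ) : (ι → α) → ℝ :=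
  fun ω => ∑ a, w a * f (Function.update ω e a)

theorem add (f g : (ι → α) → ℝ) :
    productMean w (fun ω => f ω + g ω) = productMean w f + productMean w g := by
  simp [productMean, mul_add, Finset.sum_add_distrib]

theorem sub (f g : (ι → α) → ℝ) :
    productMean w (fun ω => f ω - g ω) = productMean w f - productMean w g := by
  simp [productMean, mul_sub, Finset.sum_sub_distrib]

theorem const_mul (c : ℝ) (f : (ι → α) → ℝ) :
    productMean w (fun ω => c * f ω) = c * productMean w f := by
  simp only [productMean, Finset.mul_sum]
  exact Finset.sum_congr rfl fun ω _ => by ring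

theorem sum {κ : Type*} (s : Finset κ) (f : κ → (ι → α) → ℝ) :
    productMean w (fun ω => ∑ k ∈ s, f k ω) = ∑ k ∈ s, productMean w (f k) := by
  simp only [productMean, Finset.mul_sum]
  exact Finset.sum_comm

theorem const (hw1 : ∑ a, w a = 1) (c : ℝ) :
    productMean w (fun _ : ι → α => c) = c := by
  have : ∑ ω : ι → α, ∏ e, w (ω e) = 1 := by
    rw [← Fintype.prod_sum]; simp [hw1]
  simp [productMean, ← Finset.sum_mul, this]

theorem mono (hw : ∀ a, 0 ≤ w a) {f g : (ι → α) → ℝ} (h : ∀ ω, f ω ≤ g ω) :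
    productMean w f ≤ productMean w g :=
  Finset.sum_le_sum fun ω _ =>
    mul_le_mul_of_nonneg_left (h ω) (Finset.prod_nonneg fun _ _ => hw _)

theorem nonneg (hw : ∀ a, 0 ≤ w a) {f : (ι → α) → ℝ} (h : ∀ ω, 0 ≤ f ω) :
    0 ≤ productMean w f :=
  Finset.sum_nonneg fun ω _ => mul_nonneg (Finset.prod_nonneg fun _ _ => hw _) (h ω)

theorem sq_mul_le (hw : ∀ a, 0 ≤ w a) (f g : (ι → α) → ℝ) :
    productMean w (fun ω => f ω * g ω) ^ 2 ≤
      productMean w (fun ω => f ω ^ 2) * productMean w (fun ω => g ω ^ 2) := by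
  have h0 (ω : ι → α) : 0 ≤ ∏ e, w (ω e) := Finset.prod_nonneg fun _ _ => hw _
  exact Finset.sum_sq_le_sum_mul_sum_of_sq_le_mul _ (fun ω _ => mul_nonneg (h0 ω) (sq_nonneg _))
    (fun ω _ => mul_nonneg (h0 ω) (sq_nonneg _)) (fun ω _ => le_of_eq (by ring))

theorem sq_le (hw : ∀ a, 0 ≤ w a) (hw1 : ∑ a, w a = 1) (f : (ι → α) → ℝ) :
    productMean w f ^ 2 ≤ productMean w (fun ω => f ω ^ 2) := by
  have := sq_mul_le hw f (fun _ => 1)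
  simpa [const hw1] using this

/-- Resampling one coordinate does not change the expectation. -/
theorem resample (e : ι) (F : α → (ι → α) → ℝ) :
    productMean w (fun ω => ∑ a, w a * F (ω e) (Function.update ω e a)) =
      productMean w (fun ω => ∑ a, w a * F a ω) := by
  simp only [productMean, Finset.mul_sum]
  rw [← Finset.sum_product', ← Finset.sum_product']
  -- Swapping the coordinate at `e` with its independent copy is an involution that preserves the
  -- product weight.
  let σ : (ι → α) × α → (ι → α) × α := fun x => (Function.update x.1 e x.2, x.1 e)
  have hσ : Function.Involutive σ := by
    rintro ⟨ω, a⟩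
    simp [σ]
  refine Fintype.sum_equiv hσ.toPerm _ _ ?_
  rintro ⟨ω, a⟩
  simp only [Function.Involutive.coe_toPerm, σ]
  have key : (∏ x, w (ω x)) * w a = (∏ x, w (Function.update ω e a x)) * w (ω e) := by
    rw [← Finset.mul_prod_erase _ _ (Finset.mem_univ e),
      ← Finset.mul_prod_erase _ (fun x => w (Function.update ω e a x)) (Finset.mem_univ e)]
    have : ∏ x ∈ Finset.univ.erase e, w (Function.update ω e a x) =
        ∏ x ∈ Finset.univ.erase e, w (ω x) :=
      Finset.prod_congr rfl fun x hx => by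
        rw [Function.update_of_ne (Finset.ne_of_mem_erase hx)]
    rw [this, Function.update_self]
    ring
  rw [← mul_assoc, key, mul_assoc]

theorem avg_eq (hw1 : ∑ a, w a = 1) (e : ι) (f : (ι → α) → ℝ) :
    productMean w (avg w e f) = productMean w f := by
  have := resample (w := w) e (fun _ => f)
  simp only [← Finset.sum_mul, hw1, one_mul] at this
  exact this

/-- A function that does not depend on the coordinates in `s` is independent of them. -/
theorem mul_prod (hw1 : ∑ a, w a = 1) (s : Finset ι) (f : (ι → α) → ℝ)
    (hf : ∀ ω ω', (∀ e ∉ s, ω e = ω' e) → f ω = f ω') (h : ι → α → ℝ) :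
    productMean w (fun ω => f ω * ∏ e ∈ s, h e (ω e)) =
      productMean w f * ∏ e ∈ s, ∑ a, w a * h e a := by
  induction s using Finset.induction_on with
  | empty => simp
  | insert e s he ih =>
    rw [Finset.prod_insert he, ← mul_assoc, mul_comm (productMean w f), mul_assoc,
      ← ih fun ω ω' hω => hf ω ω' fun x hx => hω x fun hxs => hx (Finset.mem_insert_of_mem hxs),
      ← avg_eq hw1 e, ← const_mul]
    congr 1
    funext ω
    simp only [avg, Finset.sum_mul]
    refine Finset.sum_congr rfl fun a _ => ?_
    rw [Finset.prod_insert he, Function.update_self,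
      hf (Function.update ω e a) ω fun x hx => Function.update_of_ne (by grind) _ _,
      Finset.prod_congr rfl fun x hx => by
        rw [Function.update_of_ne (by rintro rfl; exact he hx)]]
    ring

theorem avg_sub (e : ι) (f g : (ι → α) → ℝ) :
    avg w e (fun ω => f ω - g ω) = fun ω => avg w e f ω - avg w e g ω := by
  funext ω
  simp [avg, mul_sub, Finset.sum_sub_distrib]

theorem avg_comm (e e' : ι) (f : (ι → α) → ℝ) :
    avg w e (avg w e' f) = avg w e' (avg w e f) := by
  rcases eq_or_ne e e' with rfl | h
  · rfl
  funext ω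
  simp only [avg, Finset.mul_sum]
  rw [Finset.sum_comm]
  refine Finset.sum_congr rfl fun a _ => Finset.sum_congr rfl fun a' _ => ?_
  rw [Function.update_comm h]
  ring

theorem avg_sq_le (hw : ∀ a, 0 ≤ w a) (hw1 : ∑ a, w a = 1) (e : ι) (f : (ι → α) → ℝ) (ω : ι → α) :
    avg w e f ω ^ 2 ≤ avg w e (fun ω => f ω ^ 2) ω := by
  have := Finset.sum_sq_le_sum_mul_sum_of_sq_le_mul Finset.univ
    (r := fun a => w a * f (Function.update ω e a)) (f := w)
    (g := fun a => w a * f (Function.update ω e a) ^ 2) (fun a _ => hw a)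
    (fun a _ => mul_nonneg (hw a) (sq_nonneg _)) (fun a _ => le_of_eq (by ring))
  simpa [hw1, avg] using this

/-- The average of `f` over all coordinates in a list. -/
noncomputable def avgList (w : α → ℝ) (l : List ι) (f : (ι → α) → ℝ) : (ι → α) → ℝ :=
  l.foldr (avg w) f

theorem avgList_eq (hw1 : ∑ a, w a = 1) (l : List ι) (f : (ι → α) → ℝ) :
    productMean w (avgList w l f) = productMean w f := by
  induction l with
  | nil => rfl
  | cons e l ih => exact (avg_eq hw1 e _).trans ih

theorem avgList_sub (l : List ι) (f g : (ι → α) → ℝ) :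
    avgList w l (fun ω => f ω - g ω) = fun ω => avgList w l f ω - avgList w l g ω := by
  induction l with
  | nil => rfl
  | cons e l ih => simp only [avgList, List.foldr_cons] at ih ⊢; rw [ih, avg_sub]

theorem avgList_avg (l : List ι) (e : ι) (f : (ι → α) → ℝ) :
    avgList w l (avg w e f) = avg w e (avgList w l f) := by
  induction l with
  | nil => rfl
  | cons e' l ih => simp only [avgList, List.foldr_cons] at ih ⊢; rw [ih, avg_comm]

theorem avgList_sq_le (hw : ∀ a, 0 ≤ w a) (hw1 : ∑ a, w a = 1) (l : List ι) (f : (ι → α) → ℝ) :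
    productMean w (fun ω => avgList w l f ω ^ 2) ≤ productMean w (fun ω => f ω ^ 2) := by
  induction l with
  | nil => exact le_rfl
  | cons e l ih =>
    refine le_trans ?_ ih
    rw [← avg_eq hw1 e (fun ω => avgList w l f ω ^ 2)]
    exact mono hw fun ω => avg_sq_le hw hw1 e _ ω

theorem avgList_congr (l : List ι) (f : (ι → α) → ℝ) (ω ω' : ι → α)
    (h : ∀ e ∉ l, ω e = ω' e) : avgList w l f ω = avgList w l f ω' := by
  induction l generalizing ω ω' with
  | nil =>
    have : ω = ω' := funext fun e => h e List.not_mem_nil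
    rw [this]
  | cons e l ih =>
    refine Finset.sum_congr rfl fun a _ => ?_
    congr 1
    refine ih _ _ fun x hx => ?_
    rcases eq_or_ne x e with rfl | hxe
    · simp
    · simp only [Function.update_of_ne hxe]
      exact h x (by simp [hxe, hx])

/-- Averaging over a coordinate is an orthogonal projection in L², because the average no longer
depends on that coordinate; `sq_sub_avg` is the resulting Pythagoras identity. -/
theorem mul_avg (hw1 : ∑ a, w a = 1) (e : ι) (f : (ι → α) → ℝ) :
    productMean w (fun ω => f ω * avg w e f ω) = productMean w (fun ω => avg w e f ω ^ 2) := by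
  rw [← avg_eq hw1 e (fun ω => f ω * avg w e f ω)]
  congr 1
  funext ω
  have (a : α) : avg w e f (Function.update ω e a) = avg w e f ω := by simp [avg]
  simp only [avg.eq_1 w e fun ω => f ω * avg w e f ω, this, ← mul_assoc, ← Finset.sum_mul]
  rw [pow_two]
  rfl

theorem sq_sub_avg (hw1 : ∑ a, w a = 1) (e : ι) (f : (ι → α) → ℝ) :
    productMean w (fun ω => (f ω - avg w e f ω) ^ 2) =
      productMean w (fun ω => f ω ^ 2) - productMean w (fun ω => avg w e f ω ^ 2) := by
  have : (fun ω => (f ω - avg w e f ω) ^ 2) =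
      fun ω => f ω ^ 2 + avg w e f ω ^ 2 - 2 * (f ω * avg w e f ω) := by funext ω; ring
  rw [this, sub, add, const_mul, mul_avg hw1]
  ring

/-- The left side telescopes along the list. With `g = avgList w l f`, averaging over one more
coordinate `e` loses the second moment of `g - avg w e g`. As averages commute, this difference is
`avgList w l` applied to `f - avg w e f`, and averaging contracts L². -/
theorem sub_avgList_sq_le (hw : ∀ a, 0 ≤ w a) (hw1 : ∑ a, w a = 1) (l : List ι)
    (f : (ι → α) → ℝ) :
    productMean w (fun ω => f ω ^ 2) - productMean w (fun ω => avgList w l f ω ^ 2) ≤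
      (l.map fun e => productMean w (fun ω => (f ω - avg w e f ω) ^ 2)).sum := by
  induction l with
  | nil => simp [avgList]
  | cons e l ih =>
    rw [List.map_cons, List.sum_cons]
    have h1 := sq_sub_avg hw1 e (avgList w l f)
    have h2 := avgList_sq_le hw hw1 l (fun ω => f ω - avg w e f ω)
    rw [avgList_sub, avgList_avg] at h2
    have h3 : avgList w (e :: l) f = avg w e (avgList w l f) := rfl
    rw [h3]
    linarith

/-- The Efron–Stein inequality. -/
theorem variance_le (hw : ∀ a, 0 ≤ w a) (hw1 : ∑ a, w a = 1) (f : (ι → α) → ℝ) :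
    productMean w (fun ω => (f ω - productMean w f) ^ 2) ≤
      ∑ e, productMean w (fun ω => ∑ a, w a * (f ω - f (Function.update ω e a)) ^ 2) := by
  -- Averaging over every coordinate leaves a constant, which must be the mean.
  have hconst (ω : ι → α) : avgList w Finset.univ.toList f ω = productMean w f := by
    rw [← avgList_eq hw1 Finset.univ.toList f, ← const (ι := ι) hw1 (avgList w _ f ω)]
    congr 1
    funext ω'
    exact avgList_congr _ _ _ _ (by simp)
  have h1 := sub_avgList_sq_le hw hw1 Finset.univ.toList f
  simp only [hconst, const hw1, Finset.sum_map_toList] at h1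
  have h2 : productMean w (fun ω => (f ω - productMean w f) ^ 2) =
      productMean w (fun ω => f ω ^ 2) - productMean w f ^ 2 := by
    have : (fun ω => (f ω - productMean w f) ^ 2) =
      fun ω => f ω ^ 2 + productMean w f ^ 2 - (2 * productMean w f) * f ω := by funext ω; ring
    rw [this, sub, add, const_mul, const hw1]
    ring
  rw [h2]
  refine h1.trans (Finset.sum_le_sum fun e _ => mono hw fun ω => ?_)
  -- Jensen, with the value `f ω` frozen as a constant while coordinate `e` is resampled.
  have := avg_sq_le hw hw1 e (fun ω' => f ω - f ω') ω
  refine le_trans (le_of_eq ?_) this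
  simp [avg, mul_sub, Finset.sum_sub_distrib, ← Finset.sum_mul, hw1]

end productMean

/-! ### Real-valued indicators. -/

open Classical in
/-- The indicator of a proposition, as a real number. -/
noncomputable def oneIf (P : Prop) : ℝ := if P then 1 else 0

theorem oneIf_true {P : Prop} (h : P) : oneIf P = 1 := if_pos h

theorem oneIf_false {P : Prop} (h : ¬ P) : oneIf P = 0 := if_neg h

theorem oneIf_nonneg (P : Prop) : 0 ≤ oneIf P := by unfold oneIf; split_ifs <;> norm_num

theorem oneIf_le_one (P : Prop) : oneIf P ≤ 1 := by unfold oneIf; split_ifs <;> norm_num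

theorem oneIf_and (P Q : Prop) : oneIf (P ∧ Q) = oneIf P * oneIf Q := by
  by_cases hP : P <;> by_cases hQ : Q <;> simp [oneIf, hP, hQ]

theorem oneIf_sq (P : Prop) : oneIf P ^ 2 = oneIf P := by
  by_cases hP : P <;> simp [oneIf, hP]

theorem oneIf_mono {P Q : Prop} (h : P → Q) : oneIf P ≤ oneIf Q := by
  by_cases hP : P
  · rw [oneIf_true hP, oneIf_true (h hP)]
  · rw [oneIf_false hP]; exact oneIf_nonneg Q

theorem card_eq_sum_oneIf {V : Type*} [Fintype V] (s : Finset V) :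
    (s.card : ℝ) = ∑ v, oneIf (v ∈ s) := by
  simp [oneIf]

/-! ### Balls and spheres in a finite graph. -/

namespace SimpleGraph

section OpenBall

variable {V : Type*} [Fintype V] [DecidableEq V] {G G' : SimpleGraph V} {r u v : V}

open Classical in
/-- The vertices at distance less than `k` from `r`. -/
noncomputable def openBall (G : SimpleGraph V) (r : V) (k : ℕ) : Finset V :=
  Finset.univ.filter (· ∈ G.ball r k)

/-- The vertices at distance exactly `k` from `r`. -/
noncomputable def sphere (G : SimpleGraph V) (r : V) (k : ℕ) : Finset V :=
  G.openBall r (k + 1) \ G.openBall r k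

theorem mem_openBall {k : ℕ} : v ∈ G.openBall r k ↔ G.edist r v < k := by
  simp only [openBall, Finset.mem_filter, Finset.mem_univ, true_and]
  rw [mem_ball, edist_comm]

theorem mem_openBall_comm {k : ℕ} : v ∈ G.openBall r k ↔ r ∈ G.openBall v k := by
  rw [mem_openBall, mem_openBall, edist_comm]

theorem openBall_zero : G.openBall r 0 = ∅ := by
  ext v; simp [mem_openBall]

theorem openBall_mono {j k : ℕ} (h : j ≤ k) : G.openBall r j ⊆ G.openBall r k := fun v hv => by
  rw [mem_openBall] at hv ⊢
  exact hv.trans_le (by exact_mod_cast h)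

theorem openBall_mono_left (h : G ≤ G') (k : ℕ) : G.openBall r k ⊆ G'.openBall r k :=
  fun v hv => by
    rw [mem_openBall] at hv ⊢
    exact (edist_anti h).trans_lt hv

theorem mem_openBall_succ_iff_walk {k : ℕ} :
    v ∈ G.openBall r (k + 1) ↔ ∃ p : G.Walk r v, p.length ≤ k := by
  rw [mem_openBall]
  constructor
  · intro h
    obtain ⟨p, hp⟩ := exists_walk_of_edist_ne_top (h.trans (ENat.natCast_lt_top _)).ne
    refine ⟨p, ?_⟩
    rw [← hp] at h
    exact Nat.lt_succ_iff.1 (by exact_mod_cast h)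
  · rintro ⟨p, hp⟩
    exact (edist_le p).trans_lt (by exact_mod_cast Nat.lt_succ_of_le hp)

theorem mem_openBall_succ {k : ℕ} :
    v ∈ G.openBall r (k + 1) ↔ v = r ∨ ∃ u ∈ G.openBall r k, G.Adj u v := by
  cases k with
  | zero =>
    rw [mem_openBall_succ_iff_walk, openBall_zero]
    constructor
    · rintro ⟨p, hp⟩
      exact Or.inl (Walk.eq_of_length_eq_zero (Nat.le_zero.1 hp)).symm
    · rintro (rfl | ⟨u, hu, -⟩)
      · exact ⟨.nil, le_rfl⟩
      · simp at hu
  | succ k =>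
    rw [mem_openBall_succ_iff_walk]
    constructor
    · rintro ⟨p, hp⟩
      by_cases hnil : p.Nil
      · exact Or.inl hnil.eq.symm
      · refine Or.inr ⟨p.penultimate, mem_openBall_succ_iff_walk.2 ⟨p.dropLast, ?_⟩,
          p.adj_penultimate hnil⟩
        have : p.dropLast.length = p.length - 1 := by
          simp [Walk.dropLast, Walk.take_length]
        omega
    · rintro (rfl | ⟨u, hu, huv⟩)
      · exact ⟨.nil, Nat.zero_le _⟩
      · obtain ⟨p, hp⟩ := mem_openBall_succ_iff_walk.1 hu
        exact ⟨p.concat huv, by rw [Walk.length_concat]; omega⟩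

theorem root_mem_openBall (k : ℕ) : r ∈ G.openBall r (k + 1) :=
  mem_openBall_succ.2 (Or.inl rfl)

theorem mem_openBall_succ_of_adj {k : ℕ} (hu : u ∈ G.openBall r k) (h : G.Adj u v) :
    v ∈ G.openBall r (k + 1) :=
  mem_openBall_succ.2 (Or.inr ⟨u, hu, h⟩)

theorem mem_sphere {k : ℕ} :
    v ∈ G.sphere r k ↔ v ∈ G.openBall r (k + 1) ∧ v ∉ G.openBall r k :=
  Finset.mem_sdiff

theorem sphere_zero : G.sphere r 0 = {r} := by
  ext v
  simp [mem_sphere, mem_openBall_succ, openBall_zero]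

theorem sphere_subset (k : ℕ) : G.sphere r k ⊆ G.openBall r (k + 1) :=
  Finset.sdiff_subset

theorem mem_sphere_succ {k : ℕ} :
    v ∈ G.sphere r (k + 1) ↔ v ∉ G.openBall r (k + 1) ∧ ∃ u ∈ G.sphere r k, G.Adj u v := by
  rw [mem_sphere, mem_openBall_succ, and_comm]
  refine and_congr_right fun hv => ⟨?_, ?_⟩
  · rintro (rfl | ⟨u, hu, huv⟩)
    · exact absurd (root_mem_openBall k) hv
    · exact ⟨u, mem_sphere.2 ⟨hu, fun h => hv (mem_openBall_succ_of_adj h huv)⟩, huv⟩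
  · rintro ⟨u, hu, huv⟩
    exact Or.inr ⟨u, sphere_subset k hu, huv⟩

theorem card_openBall_succ (k : ℕ) :
    (G.openBall r (k + 1)).card = (G.openBall r k).card + (G.sphere r k).card := by
  rw [add_comm (Finset.card _)]
  exact (Finset.card_sdiff_add_card_eq_card (G.openBall_mono (r := r) (Nat.le_succ k))).symm

/-- Graphs with the same edges at the vertices of a ball have the same next larger ball. -/
theorem openBall_congr {k : ℕ} (h : ∀ u ∈ G.openBall r k, ∀ v, G.Adj u v ↔ G'.Adj u v) (j : ℕ)
    (hj : j ≤ k + 1) : G'.openBall r j = G.openBall r j := by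
  induction j with
  | zero => rw [openBall_zero, openBall_zero]
  | succ j ih =>
    ext v
    rw [mem_openBall_succ, mem_openBall_succ, ih (by omega)]
    refine or_congr_right (exists_congr fun u => and_congr_right fun hu => ?_)
    exact (h u (openBall_mono (by omega) hu) v).symm

end OpenBall

end SimpleGraph

/-! ### Exploring a random graph level by level: one-step moment recursions. -/

/-- The graph on the vertices in `A` whose edges are the pairs with a mark that satisfies `b`. -/
def randomGraph {V α : Type*} (b : α → Prop) (A : Set V) (ω : Sym2 V → α) : SimpleGraph V where
  Adj u v := u ≠ v ∧ u ∈ A ∧ v ∈ A ∧ b (ω s(u, v))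
  symm := ⟨fun u _ ⟨h, hu, hv, hb⟩ => ⟨h.symm, hv, hu, Sym2.eq_swap (a := u) ▸ hb⟩⟩
  loopless := ⟨fun _ h => h.1 rfl⟩

namespace randomGraph

open SimpleGraph

variable {V α : Type*} [Fintype V] [DecidableEq V] [Fintype α] {w : α → ℝ} {b : α → Prop}
  {A : Set V} {r : V} {k : ℕ}

theorem sphere_subset_of_root_mem (hr : r ∈ A) (ω : Sym2 V → α) {u : V}
    (hu : u ∈ (randomGraph b A ω).sphere r k) : u ∈ A := by
  cases k with
  | zero => rw [sphere_zero, Finset.mem_singleton] at hu; exact hu ▸ hr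
  | succ k =>
    obtain ⟨-, x, -, hx⟩ := mem_sphere_succ.1 hu
    exact hx.2.2.1

theorem openBall_congr_of_agree {F : Finset (Sym2 V)} {ω ω' : Sym2 V → α}
    (hF : ∀ e ∈ F, ∀ x ∈ e, x ∉ (randomGraph b A ω).openBall r k)
    (h : ∀ e ∉ F, ω e = ω' e) {j : ℕ} (hj : j ≤ k + 1) :
    (randomGraph b A ω').openBall r j = (randomGraph b A ω).openBall r j := by
  refine openBall_congr (k := k) (fun u hu v => ?_) j hj
  have : s(u, v) ∉ F := fun he => hF _ he u (Sym2.mem_mk_left u v) hu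
  simp only [randomGraph, h _ this]

/-- The vertices of `s` are at distance `k` and those of `t` at distance more than `k`. -/
def Frontier (b : α → Prop) (A : Set V) (r : V) (k : ℕ) (s t : Finset V) (ω : Sym2 V → α) :
    Prop :=
  s ⊆ (randomGraph b A ω).sphere r k ∧ Disjoint t ((randomGraph b A ω).openBall r (k + 1))

/-- Spheres up to radius `k` are determined by the pairs with an endpoint at distance less than `k`.
A pair inside `s ∪ t` has no such endpoint, so its mark has not been looked at. -/
theorem Frontier.of_agree {s t : Finset V} {F : Finset (Sym2 V)}
    (hF : ∀ e ∈ F, ∀ x ∈ e, x ∈ s ∪ t) {ω ω' : Sym2 V → α} (h : ∀ e ∉ F, ω e = ω' e)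
    (hω : Frontier b A r k s t ω) : Frontier b A r k s t ω' := by
  have hF' : ∀ e ∈ F, ∀ x ∈ e, x ∉ (randomGraph b A ω).openBall r k := by
    intro e he x hx
    rcases Finset.mem_union.1 (hF e he x hx) with h | h
    · exact (mem_sphere.1 (hω.1 h)).2
    · exact fun hxk => (Finset.disjoint_left.1 hω.2 h) (openBall_mono (Nat.le_succ k) hxk)
  have h1 := openBall_congr_of_agree hF' h (le_refl (k + 1))
  have h2 := openBall_congr_of_agree hF' h (Nat.le_succ k)
  refine ⟨?_, ?_⟩
  · rw [sphere, h1, h2]; exact hω.1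
  · rw [h1]; exact hω.2

/-- The marks of the pairs inside the frontier are independent of the frontier. -/
theorem mean_frontier (hw1 : ∑ a, w a = 1) (s t : Finset V) (F : Finset (Sym2 V))
    (hF : ∀ e ∈ F, ∀ x ∈ e, x ∈ s ∪ t) :
    productMean w (fun ω => oneIf (Frontier b A r k s t ω) * ∏ e ∈ F, oneIf (b (ω e))) =
      productMean w (fun ω => oneIf (Frontier b A r k s t ω)) *
        (∑ a, w a * oneIf (b a)) ^ F.card := by
  rw [productMean.mul_prod hw1 F _ _ (fun _ a => oneIf (b a)), Finset.prod_const]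
  intro ω ω' h
  congr 1
  exact propext ⟨fun h' => h'.of_agree hF h, fun h' => h'.of_agree hF fun e he => (h e he).symm⟩

/-- The indicator of an edge between distance `k` and distance larger than `k`. -/
noncomputable def crossing (b : α → Prop) (A : Set V) (r : V) (k : ℕ) (ω : Sym2 V → α) (u v : V) :
    ℝ :=
  oneIf (Frontier b A r k {u} {v} ω) * oneIf (b (ω s(u, v)))

theorem frontier_singleton {ω : Sym2 V → α} {u v : V} :
    Frontier b A r k {u} {v} ω ↔
      u ∈ (randomGraph b A ω).sphere r k ∧ v ∉ (randomGraph b A ω).openBall r (k + 1) := by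
  simp [Frontier]

theorem crossing_nonneg (ω : Sym2 V → α) (u v : V) : 0 ≤ crossing b A r k ω u v :=
  mul_nonneg (oneIf_nonneg _) (oneIf_nonneg _)

theorem mean_crossing (hw1 : ∑ a, w a = 1) (u v : V) :
    productMean w (fun ω => crossing b A r k ω u v) =
      (∑ a, w a * oneIf (b a)) *
        productMean w (fun ω => oneIf (Frontier b A r k {u} {v} ω)) := by
  have := mean_frontier (b := b) (A := A) (r := r) (k := k) hw1 {u} {v} {s(u, v)}
    (by simp)
  simpa [crossing, mul_comm] using this

theorem crossing_mul_crossing (ω : Sym2 V → α) {u v u' v' : V} (h : s(u, v) ≠ s(u', v')) :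
    crossing b A r k ω u v * crossing b A r k ω u' v' =
      oneIf (Frontier b A r k {u, u'} {v, v'} ω) * ∏ e ∈ {s(u, v), s(u', v')}, oneIf (b (ω e)) := by
  have : Frontier b A r k {u, u'} {v, v'} ω ↔
      Frontier b A r k {u} {v} ω ∧ Frontier b A r k {u'} {v'} ω := by
    simp [Frontier, Finset.insert_subset_iff]
    tauto
  rw [Finset.prod_pair h, this, oneIf_and, crossing, crossing]
  ring

/-- Two different unordered pairs are jointly unexplored, which gives the factor `p²`. The same pair
in the two orientations contributes nothing, since an endpoint at distance `k` is not at distance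
more than `k`. -/
theorem mean_crossing_mul_crossing_le (hw : ∀ a, 0 ≤ w a) (hw1 : ∑ a, w a = 1) {u v u' v' : V}
    (h : (u, v) ≠ (u', v')) :
    productMean w (fun ω => crossing b A r k ω u v * crossing b A r k ω u' v') ≤
      (∑ a, w a * oneIf (b a)) ^ 2 *
        productMean w (fun ω => oneIf (u ∈ (randomGraph b A ω).sphere r k) *
          oneIf (u' ∈ (randomGraph b A ω).sphere r k)) := by
  have hp : 0 ≤ ∑ a, w a * oneIf (b a) :=
    Finset.sum_nonneg fun a _ => mul_nonneg (hw a) (oneIf_nonneg _)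
  by_cases he : s(u, v) = s(u', v')
  · have : (fun ω => crossing b A r k ω u v * crossing b A r k ω u' v') = fun _ => 0 := by
      funext ω
      have huv : u = v' ∧ v = u' := by
        rcases Sym2.eq_iff.1 he with ⟨rfl, rfl⟩ | h'
        · exact absurd rfl h
        · exact h'
      obtain ⟨rfl, rfl⟩ := huv
      by_cases h1 : Frontier b A r k {u} {v} ω
      · have h2 : ¬ Frontier b A r k {v} {u} ω := fun h2 =>
          (frontier_singleton.1 h2).2 (sphere_subset k (frontier_singleton.1 h1).1)
        simp [crossing, oneIf_false h2]
      · simp [crossing, oneIf_false h1]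
    rw [this, productMean.const hw1]
    exact mul_nonneg (pow_nonneg hp _) (productMean.nonneg hw fun ω =>
      mul_nonneg (oneIf_nonneg _) (oneIf_nonneg _))
  · simp only [crossing_mul_crossing _ he]
    rw [mean_frontier hw1 _ _ _ (by simp), Finset.card_pair he, mul_comm]
    refine mul_le_mul_of_nonneg_left (productMean.mono hw fun ω => ?_) (pow_nonneg hp _)
    rw [← oneIf_and]
    exact oneIf_mono fun h => ⟨h.1 (by simp), h.1 (by simp)⟩

/-- The number of vertices at distance `k`, as a real number. -/
noncomputable def size (b : α → Prop) (A : Set V) (r : V) (k : ℕ) (ω : Sym2 V → α) : ℝ :=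
  ((randomGraph b A ω).sphere r k).card

/-- The number of vertices at distance less than `k`, as a real number. -/
noncomputable def volume (b : α → Prop) (A : Set V) (r : V) (k : ℕ) (ω : Sym2 V → α) : ℝ :=
  ((randomGraph b A ω).openBall r k).card

theorem size_eq_sum (ω : Sym2 V → α) :
    size b A r k ω = ∑ u, oneIf (u ∈ (randomGraph b A ω).sphere r k) :=
  card_eq_sum_oneIf _

theorem size_nonneg (ω : Sym2 V → α) : 0 ≤ size b A r k ω := Nat.cast_nonneg _

theorem volume_succ (ω : Sym2 V → α) :
    volume b A r (k + 1) ω = volume b A r k ω + size b A r k ω := by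
  simp only [volume, size, card_openBall_succ, Nat.cast_add]

theorem size_succ_le (ω : Sym2 V → α) :
    size b A r (k + 1) ω ≤ ∑ x : V × V, crossing b A r k ω x.1 x.2 := by
  rw [size_eq_sum, Fintype.sum_prod_type_right]
  refine Finset.sum_le_sum fun v _ => ?_
  by_cases hv : v ∈ (randomGraph b A ω).sphere r (k + 1)
  · obtain ⟨h1, u, hu, huv⟩ := mem_sphere_succ.1 hv
    refine le_trans ?_ (Finset.single_le_sum (f := fun u => crossing b A r k ω u v)
      (fun u _ => crossing_nonneg ω u v) (Finset.mem_univ u))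
    have h2 : Frontier b A r k {u} {v} ω := frontier_singleton.2 ⟨hu, h1⟩
    simp only [crossing, oneIf_true h2, oneIf_true hv, oneIf_true huv.2.2.2]
    norm_num
  · rw [oneIf_false hv]
    exact Finset.sum_nonneg fun u _ => crossing_nonneg ω u v

variable {p : ℝ}

theorem prob_nonneg (hw : ∀ a, 0 ≤ w a) (hp : ∑ a, w a * oneIf (b a) = p) : 0 ≤ p :=
  hp ▸ Finset.sum_nonneg fun a _ => mul_nonneg (hw a) (oneIf_nonneg _)

theorem mean_size_succ_le (hw : ∀ a, 0 ≤ w a) (hw1 : ∑ a, w a = 1)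
    (hp : ∑ a, w a * oneIf (b a) = p) :
    productMean w (size b A r (k + 1)) ≤
      p * Fintype.card V * productMean w (size b A r k) := by
  refine (productMean.mono hw size_succ_le).trans ?_
  rw [productMean.sum, Fintype.sum_prod_type]
  simp only [mean_crossing hw1, hp]
  have h1 (u v : V) : p * productMean w (fun ω => oneIf (Frontier b A r k {u} {v} ω)) ≤
      p * productMean w (fun ω => oneIf (u ∈ (randomGraph b A ω).sphere r k)) :=
    mul_le_mul_of_nonneg_left (productMean.mono hw fun ω =>
      oneIf_mono fun h => (frontier_singleton.1 h).1) (prob_nonneg hw hp)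
  refine (Finset.sum_le_sum fun u _ => Finset.sum_le_sum fun v _ => h1 u v).trans (le_of_eq ?_)
  have h2 : size b A r k = fun ω => ∑ u, oneIf (u ∈ (randomGraph b A ω).sphere r k) := by
    funext ω; exact size_eq_sum ω
  rw [h2, productMean.sum]
  simp only [Finset.sum_const, Finset.card_univ, nsmul_eq_mul, Finset.mul_sum]
  exact Finset.sum_congr rfl fun u _ => by ring

theorem size_sq (ω : Sym2 V → α) :
    size b A r k ω ^ 2 = ∑ u, ∑ u', oneIf (u ∈ (randomGraph b A ω).sphere r k) *
          oneIf (u' ∈ (randomGraph b A ω).sphere r k) := by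
  rw [size_eq_sum, pow_two, Finset.sum_mul_sum]

theorem mean_size_sq :
    productMean w (fun ω => size b A r k ω ^ 2) =
      ∑ u, ∑ u', productMean w (fun ω => oneIf (u ∈ (randomGraph b A ω).sphere r k) *
          oneIf (u' ∈ (randomGraph b A ω).sphere r k)) := by
  simp only [size_sq, productMean.sum]

/-- The sphere is dominated by the number of crossing edges. In the square of that number, distinct
crossings give the term in `p²` and the diagonal gives the linear term. -/
theorem mean_size_succ_sq_le (hw : ∀ a, 0 ≤ w a) (hw1 : ∑ a, w a = 1)
    (hp : ∑ a, w a * oneIf (b a) = p) :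
    productMean w (fun ω => size b A r (k + 1) ω ^ 2) ≤
      (p * Fintype.card V) ^ 2 * productMean w (fun ω => size b A r k ω ^ 2) +
        p * Fintype.card V * productMean w (size b A r k) := by
  have hp0 := prob_nonneg hw hp
  refine (productMean.mono hw fun ω =>
    pow_le_pow_left₀ (size_nonneg ω) (size_succ_le ω) 2).trans ?_
  simp only [pow_two (∑ x : V × V, crossing b A r k _ x.1 x.2), Finset.sum_mul_sum,
    productMean.sum]
  have key (x y : V × V) :
      productMean w (fun ω => crossing b A r k ω x.1 x.2 * crossing b A r k ω y.1 y.2) ≤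
      p ^ 2 * productMean w (fun ω => oneIf (x.1 ∈ (randomGraph b A ω).sphere r k) *
          oneIf (y.1 ∈ (randomGraph b A ω).sphere r k)) +
        if x = y then p * productMean w (fun ω => oneIf (x.1 ∈ (randomGraph b A ω).sphere r k))
          else 0 := by
    split_ifs with hxy
    · subst hxy
      have h1 : productMean w (fun ω => crossing b A r k ω x.1 x.2 * crossing b A r k ω x.1 x.2) =
          productMean w (fun ω => crossing b A r k ω x.1 x.2) := by
        congr 1; funext ω
        rw [← pow_two, crossing, mul_pow, oneIf_sq, oneIf_sq]
      rw [h1, mean_crossing hw1, hp]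
      refine le_trans ?_ (le_add_of_nonneg_left (mul_nonneg (pow_nonneg hp0 2)
        (productMean.nonneg hw fun ω => mul_nonneg (oneIf_nonneg _) (oneIf_nonneg _))))
      exact mul_le_mul_of_nonneg_left (productMean.mono hw fun ω =>
        oneIf_mono fun h => (frontier_singleton.1 h).1) hp0
    · rw [add_zero, ← hp]
      exact mean_crossing_mul_crossing_le hw hw1 hxy
  refine (Finset.sum_le_sum fun x _ => Finset.sum_le_sum fun y _ => key x y).trans (le_of_eq ?_)
  have h2 : size b A r k = fun ω => ∑ u, oneIf (u ∈ (randomGraph b A ω).sphere r k) := by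
    funext ω; exact size_eq_sum ω
  simp only [Finset.sum_add_distrib, Finset.sum_ite_eq, Finset.mem_univ, if_true,
    Fintype.sum_prod_type]
  rw [mean_size_sq, h2, productMean.sum]
  simp only [Finset.sum_const, Finset.card_univ, nsmul_eq_mul, Finset.mul_sum]
  congr 1
  · refine Finset.sum_congr rfl fun u _ => Finset.sum_congr rfl fun u' _ => by ring
  · exact Finset.sum_congr rfl fun u _ => by ring

/-- The number of ordered pairs of edges that lead from two distinct vertices at distance `k` to
the same vertex at a larger distance. -/
noncomputable def collisions (b : α → Prop) (A : Set V) (r : V) (k : ℕ) (ω : Sym2 V → α) : ℝ :=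
  ∑ v, ∑ u, ∑ u', oneIf (u ≠ u') * (crossing b A r k ω u v * crossing b A r k ω u' v)

theorem mean_collisions_le (hw : ∀ a, 0 ≤ w a) (hw1 : ∑ a, w a = 1)
    (hp : ∑ a, w a * oneIf (b a) = p) :
    productMean w (collisions b A r k) ≤
      p ^ 2 * Fintype.card V * productMean w (fun ω => size b A r k ω ^ 2) := by
  have h1 : productMean w (collisions b A r k) = ∑ v, ∑ u, ∑ u', productMean w
      (fun ω => oneIf (u ≠ u') * (crossing b A r k ω u v * crossing b A r k ω u' v)) := by
    unfold collisions
    simp only [productMean.sum]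
  have key (u u' v : V) : productMean w
      (fun ω => oneIf (u ≠ u') * (crossing b A r k ω u v * crossing b A r k ω u' v)) ≤
      p ^ 2 * productMean w (fun ω => oneIf (u ∈ (randomGraph b A ω).sphere r k) *
          oneIf (u' ∈ (randomGraph b A ω).sphere r k)) := by
    by_cases h : u = u'
    · simp only [oneIf_false (not_not.2 h), zero_mul, productMean.const hw1]
      exact mul_nonneg (pow_nonneg (prob_nonneg hw hp) _) (productMean.nonneg hw fun ω =>
        mul_nonneg (oneIf_nonneg _) (oneIf_nonneg _))
    · simp only [oneIf_true h, one_mul]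
      rw [← hp]
      exact mean_crossing_mul_crossing_le hw hw1 fun he => h (congrArg Prod.fst he)
  rw [h1, mean_size_sq]
  refine (Finset.sum_le_sum fun v _ => Finset.sum_le_sum fun u _ => Finset.sum_le_sum fun u' _ =>
    key u u' v).trans (le_of_eq ?_)
  simp only [Finset.sum_const, Finset.card_univ, nsmul_eq_mul, Finset.mul_sum]
  exact Finset.sum_congr rfl fun u _ => Finset.sum_congr rfl fun u' _ => by ring

/-- The number of ordered pairs of adjacent vertices at distance `k`. -/
noncomputable def levelEdges (b : α → Prop) (A : Set V) (r : V) (k : ℕ) (ω : Sym2 V → α) : ℝ :=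
  ∑ u, ∑ u', oneIf (Frontier b A r k {u, u'} ∅ ω) * oneIf (b (ω s(u, u')))

theorem mean_levelEdges_le (hw : ∀ a, 0 ≤ w a) (hw1 : ∑ a, w a = 1)
    (hp : ∑ a, w a * oneIf (b a) = p) :
    productMean w (levelEdges b A r k) ≤
      p * productMean w (fun ω => size b A r k ω ^ 2) := by
  have h1 : productMean w (levelEdges b A r k) = ∑ u, ∑ u', productMean w
      (fun ω => oneIf (Frontier b A r k {u, u'} ∅ ω) * oneIf (b (ω s(u, u')))) := by
    unfold levelEdges
    simp only [productMean.sum]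
  rw [h1, mean_size_sq]
  simp only [Finset.mul_sum]
  refine Finset.sum_le_sum fun u _ => Finset.sum_le_sum fun u' _ => ?_
  have := mean_frontier (b := b) (A := A) (r := r) (k := k) hw1 {u, u'} ∅ {s(u, u')} (by simp)
  simp only [Finset.prod_singleton, Finset.card_singleton, pow_one, hp] at this
  rw [this, mul_comm]
  refine mul_le_mul_of_nonneg_left (productMean.mono hw fun ω => ?_) (prob_nonneg hw hp)
  rw [← oneIf_and]
  exact oneIf_mono fun h => ⟨h.1 (by simp), h.1 (by simp)⟩

-- If `t` crossing edges lead to `v`, then `v` contributes `t² - t` collisions, and `t - (t² - t) ≤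
-- 1` because `(t - 1)² ≥ 0`. Subtracting the collisions thus corrects the multiple counting of `v`.
open Classical in
theorem le_size_succ (hr : r ∈ A) (ω : Sym2 V → α) :
    ∑ v, ∑ u, oneIf (v ∈ A) * crossing b A r k ω u v - collisions b A r k ω ≤
      size b A r (k + 1) ω := by
  rw [size_eq_sum, collisions, ← Finset.sum_sub_distrib]
  refine Finset.sum_le_sum fun v _ => ?_
  set t := ∑ u, crossing b A r k ω u v with ht
  have hsq (u : V) : crossing b A r k ω u v * crossing b A r k ω u v = crossing b A r k ω u v := by
    rw [← pow_two, crossing, mul_pow, oneIf_sq, oneIf_sq]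
  have h1 : ∑ u, ∑ u', oneIf (u ≠ u') * (crossing b A r k ω u v * crossing b A r k ω u' v) =
      t ^ 2 - t := by
    have h2 (u u' : V) : oneIf (u ≠ u') * (crossing b A r k ω u v * crossing b A r k ω u' v) =
        crossing b A r k ω u v * crossing b A r k ω u' v -
          if u = u' then crossing b A r k ω u v else 0 := by
      split_ifs with h
      · subst h; rw [oneIf_false (by simp), hsq]; ring
      · rw [oneIf_true h]; ring
    simp only [h2, Finset.sum_sub_distrib, Finset.sum_ite_eq, Finset.mem_univ, if_true]
    rw [← Finset.sum_mul_sum, ← pow_two]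
  have ht0 : 0 ≤ t := Finset.sum_nonneg fun u _ => crossing_nonneg ω u v
  have hnn : 0 ≤ t ^ 2 - t := by
    rw [← h1]
    exact Finset.sum_nonneg fun u _ => Finset.sum_nonneg fun u' _ =>
      mul_nonneg (oneIf_nonneg _) (mul_nonneg (crossing_nonneg ω u v) (crossing_nonneg ω u' v))
  rw [h1, ← Finset.mul_sum, ← ht]
  by_cases hv : v ∈ (randomGraph b A ω).sphere r (k + 1)
  · rw [oneIf_true hv]
    have := mul_le_mul_of_nonneg_right (oneIf_le_one (v ∈ A)) ht0
    nlinarith [sq_nonneg (t - 1)]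
  · rw [oneIf_false hv]
    suffices oneIf (v ∈ A) * t = 0 by linarith
    by_cases hvA : v ∈ A
    · rw [oneIf_true hvA, one_mul, ht]
      refine Finset.sum_eq_zero fun u _ => ?_
      by_contra hne
      have hf : Frontier b A r k {u} {v} ω := by
        by_contra hf; exact hne (by simp [crossing, oneIf_false hf])
      have hb : b (ω s(u, v)) := by
        by_contra hb; exact hne (by simp [crossing, oneIf_false hb])
      obtain ⟨hu, hv'⟩ := frontier_singleton.1 hf
      exact hv (mem_sphere_succ.2 ⟨hv', u, hu, fun h => hv' (h ▸ sphere_subset k hu),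
        sphere_subset_of_root_mem hr ω hu, hvA, hb⟩)
    · rw [oneIf_false hvA, zero_mul]

theorem size_le_volume (ω : Sym2 V → α) : size b A r k ω ≤ volume b A r (k + 1) ω := by
  exact Nat.cast_le.2 (Finset.card_le_card (sphere_subset k))

theorem one_le_volume (ω : Sym2 V → α) : 1 ≤ volume b A r (k + 1) ω := by
  exact Nat.one_le_cast.2 (Finset.card_pos.2 ⟨r, root_mem_openBall k⟩)

/-- Each vertex of the sphere can reach all of `A` outside the ball already explored. The excluded
targets cost at most `2 * volume²` pairs, hence the term `2 * p`; the collisions account for `p * (p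
* |V|)`. -/
theorem le_mean_size_succ (hw : ∀ a, 0 ≤ w a) (hw1 : ∑ a, w a = 1)
    (hp : ∑ a, w a * oneIf (b a) = p) (hr : r ∈ A)
    (hA : (Fintype.card V : ℝ) - 1 ≤ ∑ v, oneIf (v ∈ A)) :
    p * Fintype.card V * productMean w (size b A r k) -
      p * (2 + p * Fintype.card V) * productMean w (fun ω => volume b A r (k + 1) ω ^ 2) ≤
      productMean w (size b A r (k + 1)) := by
  have hp0 := prob_nonneg hw hp
  refine le_trans ?_ (productMean.mono hw (le_size_succ hr))
  rw [productMean.sub]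
  have h1 : productMean w (fun ω => ∑ v, ∑ u, oneIf (v ∈ A) * crossing b A r k ω u v) =
      p * productMean w (fun ω => ∑ v, ∑ u, oneIf (v ∈ A) *
        oneIf (Frontier b A r k {u} {v} ω)) := by
    simp only [productMean.sum, productMean.const_mul, mean_crossing hw1, hp, Finset.mul_sum]
    exact Finset.sum_congr rfl fun v _ => Finset.sum_congr rfl fun u _ => by ring
  have h2 (ω : Sym2 V → α) : ∑ v, ∑ u, oneIf (v ∈ A) * oneIf (Frontier b A r k {u} {v} ω) ≥
      Fintype.card V * size b A r k ω - 2 * volume b A r (k + 1) ω ^ 2 := by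
    have h3 (u v : V) : oneIf (v ∈ A) * oneIf (Frontier b A r k {u} {v} ω) ≥
        oneIf (u ∈ (randomGraph b A ω).sphere r k) *
          (oneIf (v ∈ A) - oneIf (v ∈ (randomGraph b A ω).openBall r (k + 1))) := by
      rw [frontier_singleton, oneIf_and]
      have := oneIf_nonneg (u ∈ (randomGraph b A ω).sphere r k)
      by_cases hvA : v ∈ A <;> by_cases hv : v ∈ (randomGraph b A ω).openBall r (k + 1) <;>
        simp [oneIf, hvA, hv] <;> split_ifs <;> norm_num
    have h4 : ∑ v, ∑ u, oneIf (u ∈ (randomGraph b A ω).sphere r k) *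
          (oneIf (v ∈ A) - oneIf (v ∈ (randomGraph b A ω).openBall r (k + 1))) =
        size b A r k ω * (∑ v, oneIf (v ∈ A) - volume b A r (k + 1) ω) := by
      rw [size_eq_sum, volume, card_eq_sum_oneIf, ← Finset.sum_sub_distrib, Finset.sum_comm,
        Finset.sum_mul_sum]
    refine le_trans ?_ (Finset.sum_le_sum fun v _ => Finset.sum_le_sum fun u _ => h3 u v)
    rw [h4]
    have h5 := size_le_volume (b := b) (A := A) (r := r) (k := k) ω
    have h6 := one_le_volume (b := b) (A := A) (r := r) (k := k) ω
    have h7 := size_nonneg (b := b) (A := A) (r := r) (k := k) ω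
    have h8 := mul_le_mul_of_nonneg_left hA h7
    nlinarith
  have h9 : productMean w (fun ω => ∑ v, ∑ u, oneIf (v ∈ A) *
        oneIf (Frontier b A r k {u} {v} ω)) ≥ Fintype.card V * productMean w (size b A r k) -
        2 * productMean w (fun ω => volume b A r (k + 1) ω ^ 2) := by
    rw [← productMean.const_mul, ← productMean.const_mul, ← productMean.sub]
    exact productMean.mono hw h2
  have h10 := mean_collisions_le (b := b) (A := A) (r := r) (k := k) hw hw1 hp
  have h11 : productMean w (fun ω => size b A r k ω ^ 2) ≤
      productMean w (fun ω => volume b A r (k + 1) ω ^ 2) :=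
    productMean.mono hw fun ω => pow_le_pow_left₀ (size_nonneg ω) (size_le_volume ω) 2
  have h12 := mul_le_mul_of_nonneg_left h11 (show 0 ≤ p ^ 2 * Fintype.card V by positivity)
  have h13 := mul_le_mul_of_nonneg_left h9 hp0
  rw [h1]
  linarith

end randomGraph

/-! ### Growth of spheres and the Paley–Zygmund bound in the supercritical case. -/

namespace randomGraph

open SimpleGraph

variable {V α : Type*} [Fintype V] [DecidableEq V] [Fintype α] {w : α → ℝ} {b : α → Prop}
  {A : Set V} {r : V} {k : ℕ} {p μ : ℝ}

theorem size_zero (ω : Sym2 V → α) : size b A r 0 ω = 1 := by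
  simp [size, sphere_zero]

theorem mean_size_le (hw : ∀ a, 0 ≤ w a) (hw1 : ∑ a, w a = 1)
    (hp : ∑ a, w a * oneIf (b a) = p) (hμ : p * Fintype.card V = μ) (hμ1 : 1 < μ) (k : ℕ) :
    productMean w (size b A r k) ≤ μ ^ k := by
  induction k with
  | zero =>
    have : size b A r 0 = fun _ => 1 := funext size_zero
    rw [this, productMean.const hw1, pow_zero]
  | succ k ih =>
    refine (mean_size_succ_le hw hw1 hp).trans ?_
    rw [hμ, pow_succ, mul_comm]
    exact mul_le_mul_of_nonneg_right ih (by linarith)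

theorem mean_size_sq_le (hw : ∀ a, 0 ≤ w a) (hw1 : ∑ a, w a = 1)
    (hp : ∑ a, w a * oneIf (b a) = p) (hμ : p * Fintype.card V = μ) (hμ1 : 1 < μ) (k : ℕ) :
    productMean w (fun ω => size b A r k ω ^ 2) ≤ μ / (μ - 1) * μ ^ (2 * k) := by
  -- The term `-μ ^ k` makes the right side an exact solution of the recursion `x ↦ μ² x + μ μ^k`,
  -- so that the induction closes; it is then dropped.
  suffices h : (μ - 1) * productMean w (fun ω => size b A r k ω ^ 2) ≤ μ * μ ^ (2 * k) - μ ^ k by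
    rw [div_mul_eq_mul_div, le_div_iff₀ (by linarith), mul_comm _ (μ - 1)]
    have := pow_pos (zero_lt_one.trans hμ1) k
    linarith
  induction k with
  | zero => simp [size_zero, productMean.const hw1]
  | succ k ih =>
    have h1 := mean_size_succ_sq_le (b := b) (A := A) (r := r) (k := k) hw hw1 hp
    have h2 := mean_size_le (b := b) (A := A) (r := r) hw hw1 hp hμ hμ1 k
    rw [hμ] at h1
    have h3 := mul_le_mul_of_nonneg_left h1 (show 0 ≤ μ - 1 by linarith)
    have h4 := mul_le_mul_of_nonneg_left ih (show 0 ≤ μ ^ 2 by positivity)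
    have h5 := mul_le_mul_of_nonneg_left h2 (show 0 ≤ (μ - 1) * μ from
      mul_nonneg (by linarith) (by linarith))
    have h6 : μ ^ (2 * (k + 1)) = μ ^ (2 * k) * μ ^ 2 := by ring
    have h7 : μ ^ (k + 1) = μ ^ k * μ := by ring
    rw [h6, h7]
    linarith

theorem volume_eq_sum (ω : Sym2 V → α) (k : ℕ) :
    volume b A r k ω = ∑ j ∈ Finset.range k, size b A r j ω := by
  induction k with
  | zero => simp [volume, openBall_zero]
  | succ k ih => rw [volume_succ, ih, Finset.sum_range_succ]

/-- Cauchy–Schwarz over the levels costs a factor `K ^ 2`, which is only polylogarithmic when `K` is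
of order `log n`. -/
theorem mean_volume_sq_le (hw : ∀ a, 0 ≤ w a) (hw1 : ∑ a, w a = 1)
    (hp : ∑ a, w a * oneIf (b a) = p) (hμ : p * Fintype.card V = μ) (hμ1 : 1 < μ) {k K : ℕ}
    (hk : k ≤ K) :
    productMean w (fun ω => volume b A r k ω ^ 2) ≤ K ^ 2 * (μ / (μ - 1) * μ ^ (2 * K)) := by
  have h0 : 0 ≤ μ / (μ - 1) := div_nonneg (by linarith) (by linarith)
  have h1 (ω : Sym2 V → α) : volume b A r k ω ^ 2 ≤
      k * ∑ j ∈ Finset.range k, size b A r j ω ^ 2 := by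
    rw [volume_eq_sum]
    simpa using sq_sum_le_card_mul_sum_sq (s := Finset.range k) (f := fun j => size b A r j ω)
  refine (productMean.mono hw h1).trans ?_
  rw [productMean.const_mul, productMean.sum]
  have h2 : ∑ j ∈ Finset.range k, productMean w (fun ω => size b A r j ω ^ 2) ≤
      ∑ j ∈ Finset.range k, μ / (μ - 1) * μ ^ (2 * K) :=
    Finset.sum_le_sum fun j hj => (mean_size_sq_le hw hw1 hp hμ hμ1 j).trans
      (mul_le_mul_of_nonneg_left (pow_le_pow_right₀ hμ1.le (by
        have := Finset.mem_range.1 hj; omega)) h0)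
  rw [Finset.sum_const, Finset.card_range, nsmul_eq_mul] at h2
  refine (mul_le_mul_of_nonneg_left h2 (Nat.cast_nonneg k)).trans ?_
  rw [← mul_assoc, ← pow_two]
  have : (k : ℝ) ≤ K := by exact_mod_cast hk
  exact mul_le_mul_of_nonneg_right (pow_le_pow_left₀ (Nat.cast_nonneg k) this 2)
    (mul_nonneg h0 (pow_nonneg (by linarith) _))

theorem le_mean_size (hw : ∀ a, 0 ≤ w a) (hw1 : ∑ a, w a = 1)
    (hp : ∑ a, w a * oneIf (b a) = p) (hμ : p * Fintype.card V = μ) (hμ1 : 1 < μ) (hr : r ∈ A)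
    (hA : (Fintype.card V : ℝ) - 1 ≤ ∑ v, oneIf (v ∈ A)) {k K : ℕ} (hk : k ≤ K)
    (hK : 2 * (p * (2 + μ) * (K ^ 2 * (μ / (μ - 1) * μ ^ (2 * K)))) ≤ μ - 1) :
    μ ^ k / 2 ≤ productMean w (size b A r k) := by
  set η := p * (2 + μ) * (K ^ 2 * (μ / (μ - 1) * μ ^ (2 * K))) with hη
  have hp0 := prob_nonneg hw hp
  have hη0 : 0 ≤ η := mul_nonneg (mul_nonneg hp0 (by linarith)) (mul_nonneg (by positivity)
    (mul_nonneg (div_nonneg (by linarith) (by linarith)) (pow_nonneg (by linarith) _)))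
  -- Solution of the recursion `x ↦ μ x - η`. The assumption `2 η ≤ μ - 1` keeps the accumulated
  -- loss below half of `μ ^ k`.
  have key : (μ - 1) * μ ^ k - η * (μ ^ k - 1) ≤ (μ - 1) * productMean w (size b A r k) := by
    induction k with
    | zero =>
      have : size b A r 0 = fun _ => 1 := funext size_zero
      rw [this, productMean.const hw1]
      simp
    | succ k ih =>
      have h1 := le_mean_size_succ (k := k) hw hw1 hp hr hA
      have h2 := mean_volume_sq_le (b := b) (A := A) (r := r) hw hw1 hp hμ hμ1 hk
      have h3 := mul_le_mul_of_nonneg_left h2 (show 0 ≤ p * (2 + μ) from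
        mul_nonneg hp0 (by linarith))
      rw [← hη] at h3
      rw [hμ] at h1
      have h4 := mul_le_mul_of_nonneg_left (ih (by omega)) (show 0 ≤ μ by linarith)
      have h5 : μ * productMean w (size b A r k) - η ≤ productMean w (size b A r (k + 1)) := by
        linarith
      have h6 := mul_le_mul_of_nonneg_left h5 (show 0 ≤ μ - 1 by linarith)
      rw [pow_succ]
      linarith
  have hμk := pow_pos (zero_lt_one.trans hμ1) k
  have h7 := mul_le_mul_of_nonneg_right hK hμk.le
  have h8 : (μ - 1) * (μ ^ k / 2) ≤ (μ - 1) * productMean w (size b A r k) := by linarith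
  exact le_of_mul_le_mul_left h8 (by linarith)

/-- With probability bounded from below there are many vertices at distance `K`. -/
theorem le_prob_lt_size (hw : ∀ a, 0 ≤ w a) (hw1 : ∑ a, w a = 1)
    (hp : ∑ a, w a * oneIf (b a) = p) (hμ : p * Fintype.card V = μ) (hμ1 : 1 < μ) (hr : r ∈ A)
    (hA : (Fintype.card V : ℝ) - 1 ≤ ∑ v, oneIf (v ∈ A)) {K : ℕ}
    (hK : 2 * (p * (2 + μ) * (K ^ 2 * (μ / (μ - 1) * μ ^ (2 * K)))) ≤ μ - 1) {g : ℝ}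
    (hg0 : 0 ≤ g) (hg : 4 * g ≤ μ ^ K) :
    (μ - 1) / (16 * μ) ≤ productMean w (fun ω => oneIf (g < size b A r K ω)) := by
  have h1 := le_mean_size hw hw1 hp hμ hμ1 hr hA (le_refl K) hK
  set q := productMean w (fun ω => oneIf (g < size b A r K ω)) with hq
  set m := productMean w (fun ω => size b A r K ω * oneIf (g < size b A r K ω)) with hm
  -- Paley–Zygmund: the mean is at least `μ^K / 2` and values up to `g ≤ μ^K / 4` contribute at most
  -- `g`, so `m ≥ μ^K / 4`. Cauchy–Schwarz turns this into a bound on `q`, with `16` as the square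
  -- of `4`.
  have h2 : productMean w (size b A r K) ≤ g + m := by
    rw [← productMean.const (ι := Sym2 V) hw1 g, hm, ← productMean.add]
    refine productMean.mono hw fun ω => ?_
    by_cases h : g < size b A r K ω
    · rw [oneIf_true h]; linarith
    · rw [oneIf_false h]; linarith
  have h3 := productMean.sq_mul_le hw (size b A r K) (fun ω => oneIf (g < size b A r K ω))
  simp only [oneIf_sq, ← hq, ← hm] at h3
  have hq0 : 0 ≤ q := productMean.nonneg hw fun ω => oneIf_nonneg _
  have h4 := mul_le_mul_of_nonneg_right
    (mean_size_sq_le (b := b) (A := A) (r := r) hw hw1 hp hμ hμ1 K) hq0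
  have hμK := pow_pos (zero_lt_one.trans hμ1) K
  have h5 : μ ^ K / 4 ≤ m := by linarith
  have h6 := pow_le_pow_left₀ (by positivity) h5 2
  have h7 : μ ^ (2 * K) = (μ ^ K) ^ 2 := by ring
  rw [h7] at h4
  have h8 : (μ ^ K) ^ 2 * (1 / 16) ≤ (μ ^ K) ^ 2 * (μ / (μ - 1) * q) := by
    have := h6.trans (h3.trans h4)
    linarith
  have h9 := le_of_mul_le_mul_left h8 (by positivity)
  rw [div_mul_eq_mul_div, le_div_iff₀ (by linarith)] at h9
  rw [div_le_iff₀ (by linarith)]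
  linarith

/-! ### Nodes with two large branches. -/

/-- The vertex `i` has two neighbors from which, after removal of `i`, more than `g` vertices are at
distance `k`. -/
def Branching (b : α → Prop) (k : ℕ) (g : ℝ) (i : V) (ω : Sym2 V → α) : Prop :=
  ∃ j j', j ≠ j' ∧ j ≠ i ∧ j' ≠ i ∧ b (ω s(i, j)) ∧ b (ω s(i, j')) ∧
    g < size b {i}ᶜ j k ω ∧ g < size b {i}ᶜ j' k ω

/-- The pairs that contain `i`. -/
def star (i : V) : Finset (Sym2 V) :=
  (Finset.univ.erase i).image fun j => s(i, j)

theorem size_congr_of_agree {i j : V} {ω ω' : Sym2 V → α} (h : ∀ e ∉ star i, ω e = ω' e) :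
    size b {i}ᶜ j k ω = size b {i}ᶜ j k ω' := by
  have : randomGraph b {i}ᶜ ω = randomGraph b {i}ᶜ ω' := by
    ext u v
    simp only [randomGraph, Set.mem_compl_iff, Set.mem_singleton_iff]
    refine and_congr_right fun _ => and_congr_right fun hu => and_congr_right fun hv => ?_
    rw [h]
    simp only [star, Finset.mem_image, not_exists, not_and]
    intro x _ hx
    rcases Sym2.eq_iff.1 hx with ⟨h1, -⟩ | ⟨h1, -⟩
    · exact hu h1.symm
    · exact hv h1.symm
  rw [size, size, this]

open Classical in
/-- The indicator that `j` and `j'` are the only neighbors of `i`, as a function of the mark of a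
pair that contains `i`. -/
noncomputable def onlyNeighbors (b : α → Prop) (i j j' : V) (e : Sym2 V) (a : α) : ℝ :=
  if e ∈ ({s(i, j), s(i, j')} : Finset (Sym2 V)) then oneIf (b a) else oneIf (¬ b a)

theorem onlyNeighbors_nonneg (i j j' : V) (e : Sym2 V) (a : α) :
    0 ≤ onlyNeighbors b i j j' e a := by
  unfold onlyNeighbors; split_ifs <;> exact oneIf_nonneg _

theorem onlyNeighbors_le_one (i j j' : V) (e : Sym2 V) (a : α) :
    onlyNeighbors b i j j' e a ≤ 1 := by
  unfold onlyNeighbors; split_ifs <;> exact oneIf_le_one _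

theorem eq_or_eq_of_prod_onlyNeighbors_ne_zero {i j j' x : V} {ω : Sym2 V → α}
    (h : ∏ e ∈ star i, onlyNeighbors b i j j' e (ω e) ≠ 0) (hx : x ≠ i) :
    b (ω s(i, x)) ↔ x = j ∨ x = j' := by
  have hmem : s(i, x) ∈ star i := Finset.mem_image_of_mem _ (by simp [hx])
  have h1 := Finset.prod_ne_zero_iff.1 h _ hmem
  have h2 : s(i, x) ∈ ({s(i, j), s(i, j')} : Finset (Sym2 V)) ↔ x = j ∨ x = j' := by
    simp [hx]
  rw [← h2]
  unfold onlyNeighbors at h1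
  split_ifs at h1 with h3
  · simp only [h3, iff_true]
    by_contra hb; exact h1 (oneIf_false hb)
  · simp only [h3, iff_false]
    intro hb; exact h1 (oneIf_false (not_not.2 hb))

theorem le_prod_mean_onlyNeighbors (hw : ∀ a, 0 ≤ w a) (hw1 : ∑ a, w a = 1)
    (hp : ∑ a, w a * oneIf (b a) = p) (i j j' : V) :
    p ^ 2 * (1 - p) ^ Fintype.card V ≤
      ∏ e ∈ star i, ∑ a, w a * onlyNeighbors b i j j' e a := by
  have hp0 := prob_nonneg hw hp
  have hnot : ∑ a, w a * oneIf (¬ b a) = 1 - p := by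
    rw [← hp, ← hw1, ← Finset.sum_sub_distrib]
    refine Finset.sum_congr rfl fun a _ => ?_
    by_cases h : b a <;> simp [oneIf, h]
  have hp1 : 0 ≤ 1 - p :=
    hnot ▸ Finset.sum_nonneg fun a _ => mul_nonneg (hw a) (oneIf_nonneg _)
  have h1 (e : Sym2 V) : ∑ a, w a * onlyNeighbors b i j j' e a =
      if e ∈ ({s(i, j), s(i, j')} : Finset (Sym2 V)) then p else 1 - p := by
    unfold onlyNeighbors
    split_ifs
    · exact hp
    · exact hnot
  simp only [h1]
  rw [Finset.prod_ite, Finset.prod_const, Finset.prod_const]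
  have h2 : ((star i).filter (· ∈ ({s(i, j), s(i, j')} : Finset (Sym2 V)))).card ≤ 2 :=
    (Finset.card_le_card fun e he => (Finset.mem_filter.1 he).2).trans Finset.card_le_two
  have h3 : ((star i).filter (· ∉ ({s(i, j), s(i, j')} : Finset (Sym2 V)))).card ≤
      Fintype.card V :=
    (Finset.card_filter_le _ _).trans (Finset.card_image_le.trans (Finset.card_le_univ _))
  exact mul_le_mul (pow_le_pow_of_le_one hp0 (by linarith) h2)
    (pow_le_pow_of_le_one hp1 (by linarith) h3) (pow_nonneg hp1 _) (pow_nonneg hp0 _)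

/-- The neighborhood of `i` is a single set, so at most one unordered pair `{j, j'}` contributes. It
is counted in its two orders, each time with a term of at most `1`. -/
theorem sum_onlyNeighbors_le (g : ℝ) (i : V) (ω : Sym2 V → α) :
    ∑ j ∈ Finset.univ.erase i, ∑ j' ∈ Finset.univ.erase i, oneIf (j ≠ j') *
      (oneIf (g < size b {i}ᶜ j k ω) * oneIf (g < size b {i}ᶜ j' k ω) *
        ∏ e ∈ star i, onlyNeighbors b i j j' e (ω e)) ≤ 2 * oneIf (Branching b k g i ω) := by
  set T : V × V → ℝ := fun x => oneIf (x.1 ≠ x.2) *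
      (oneIf (g < size b {i}ᶜ x.1 k ω) * oneIf (g < size b {i}ᶜ x.2 k ω) *
        ∏ e ∈ star i, onlyNeighbors b i x.1 x.2 e (ω e)) with hT
  rw [← Finset.sum_product' (f := fun j j' => T (j, j'))]
  have hT1 (x : V × V) : T x ≤ 1 := by
    have h1 : ∏ e ∈ star i, onlyNeighbors b i x.1 x.2 e (ω e) ≤ 1 :=
      Finset.prod_le_one (fun e _ => onlyNeighbors_nonneg _ _ _ _ _)
        fun e _ => onlyNeighbors_le_one _ _ _ _ _
    have h0 : 0 ≤ ∏ e ∈ star i, onlyNeighbors b i x.1 x.2 e (ω e) :=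
      Finset.prod_nonneg fun e _ => onlyNeighbors_nonneg _ _ _ _ _
    exact mul_le_one₀ (oneIf_le_one _) (mul_nonneg (mul_nonneg (oneIf_nonneg _) (oneIf_nonneg _)) h0)
      (mul_le_one₀ (mul_le_one₀ (oneIf_le_one _) (oneIf_nonneg _) (oneIf_le_one _)) h0 h1)
  have hT2 (x : V × V) (hx : T x ≠ 0) : x.1 ≠ x.2 ∧ g < size b {i}ᶜ x.1 k ω ∧
      g < size b {i}ᶜ x.2 k ω ∧ ∏ e ∈ star i, onlyNeighbors b i x.1 x.2 e (ω e) ≠ 0 := by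
    refine ⟨?_, ?_, ?_, ?_⟩
    · by_contra h; exact hx (by simp [hT, oneIf_false (not_not.2 h)])
    · by_contra h; exact hx (by simp [hT, oneIf_false h])
    · by_contra h; exact hx (by simp [hT, oneIf_false h])
    · intro h; exact hx (by simp [hT, h])
  by_cases hall : ∀ x ∈ Finset.univ.erase i ×ˢ Finset.univ.erase i, T x = 0
  · rw [Finset.sum_eq_zero hall]
    exact mul_nonneg zero_le_two (oneIf_nonneg _)
  push Not at hall
  obtain ⟨⟨x, y⟩, hmem, hne⟩ := hall
  have hxi : x ≠ i := by simpa using (Finset.mem_product.1 hmem).1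
  have hyi : y ≠ i := by simpa using (Finset.mem_product.1 hmem).2
  obtain ⟨hxy, hgx, hgy, hprod⟩ := hT2 _ hne
  have hY : Branching b k g i ω := ⟨x, y, hxy, hxi, hyi,
    (eq_or_eq_of_prod_onlyNeighbors_ne_zero hprod hxi).2 (Or.inl rfl),
    (eq_or_eq_of_prod_onlyNeighbors_ne_zero hprod hyi).2 (Or.inr rfl), hgx, hgy⟩
  rw [oneIf_true hY, mul_one]
  have hsub (z : V × V) (hz : z ∈ Finset.univ.erase i ×ˢ Finset.univ.erase i)
      (hz' : z ∉ ({(x, y), (y, x)} : Finset (V × V))) : T z = 0 := by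
    by_contra hzne
    obtain ⟨h1, -, -, h2⟩ := hT2 _ hzne
    have hz1 : z.1 ≠ i := by simpa using (Finset.mem_product.1 hz).1
    have hz2 : z.2 ≠ i := by simpa using (Finset.mem_product.1 hz).2
    have e1 := (eq_or_eq_of_prod_onlyNeighbors_ne_zero hprod hz1).1
      ((eq_or_eq_of_prod_onlyNeighbors_ne_zero h2 hz1).2 (Or.inl rfl))
    have e2 := (eq_or_eq_of_prod_onlyNeighbors_ne_zero hprod hz2).1
      ((eq_or_eq_of_prod_onlyNeighbors_ne_zero h2 hz2).2 (Or.inr rfl))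
    apply hz'
    simp only [Finset.mem_insert, Finset.mem_singleton, Prod.ext_iff]
    simp only at e1 e2
    grind
  have hsub' : ({(x, y), (y, x)} : Finset (V × V)) ⊆
      Finset.univ.erase i ×ˢ Finset.univ.erase i := by
    intro z hz
    simp only [Finset.mem_insert, Finset.mem_singleton] at hz
    rcases hz with rfl | rfl <;> simp [hxi, hyi]
  rw [← Finset.sum_subset hsub' hsub]
  refine (Finset.sum_le_card_nsmul _ _ 1 fun z _ => hT1 z).trans ?_
  rw [nsmul_eq_mul, mul_one]
  exact_mod_cast Finset.card_le_two

/-- The branches at `j` and `j'` live in the same graph and are not independent. Instead,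
Cauchy–Schwarz bounds the second moment of the number of `j` with a large branch below by the square
of its mean; `|V|` pays for the terms `j = j'`. These branches avoid `i`, so they are independent of
the star of `i`, which has exactly the neighbors `j`, `j'` with probability at least `p² (1 -
p)^|V|`. -/
theorem le_prob_branching (hw : ∀ a, 0 ≤ w a) (hw1 : ∑ a, w a = 1)
    (hp : ∑ a, w a * oneIf (b a) = p) {g q : ℝ} (hq0 : 0 ≤ q) (i : V)
    (hq : ∀ j ≠ i, q ≤ productMean w (fun ω => oneIf (g < size b {i}ᶜ j k ω))) :
    p ^ 2 * (1 - p) ^ Fintype.card V *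
        (((Fintype.card V - 1) * q) ^ 2 - Fintype.card V) ≤
      2 * productMean w (fun ω => oneIf (Branching b k g i ω)) := by
  classical
  rw [← productMean.const_mul]
  refine le_trans ?_ (productMean.mono hw (sum_onlyNeighbors_le g i))
  simp only [productMean.sum, productMean.const_mul]
  set S := (Finset.univ : Finset V).erase i with hS
  set c := p ^ 2 * (1 - p) ^ Fintype.card V with hc
  have hcard : (S.card : ℝ) = Fintype.card V - 1 := by
    rw [hS, Finset.card_erase_of_mem (Finset.mem_univ i), Finset.card_univ,
      Nat.cast_pred (Fintype.card_pos_iff.2 ⟨i⟩)]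
  set F : V → (Sym2 V → α) → ℝ := fun j ω => oneIf (g < size b {i}ᶜ j k ω) with hF
  have hnn (j j' : V) : 0 ≤ productMean w (fun ω => F j ω * F j' ω) :=
    productMean.nonneg hw fun ω => mul_nonneg (oneIf_nonneg _) (oneIf_nonneg _)
  have key (j j' : V) : c * (productMean w (fun ω => F j ω * F j' ω) -
      if j = j' then 1 else 0) ≤ oneIf (j ≠ j') * productMean w (fun ω => F j ω * F j' ω *
        ∏ e ∈ star i, onlyNeighbors b i j j' e (ω e)) := by
    have h1 := le_prod_mean_onlyNeighbors hw hw1 hp i j j'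
    have hc0 : 0 ≤ c := by
      refine mul_nonneg (sq_nonneg _) (pow_nonneg ?_ _)
      have : p ≤ 1 := by
        rw [← hp, ← hw1]
        exact Finset.sum_le_sum fun a _ => mul_le_of_le_one_right (hw a) (oneIf_le_one _)
      linarith
    split_ifs with h
    · rw [oneIf_false (not_not.2 h), zero_mul]
      refine mul_nonpos_of_nonneg_of_nonpos hc0 (sub_nonpos.2 ?_)
      rw [← productMean.const (ι := Sym2 V) hw1 1]
      exact productMean.mono hw fun ω =>
        mul_le_one₀ (oneIf_le_one _) (oneIf_nonneg _) (oneIf_le_one _)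
    · rw [oneIf_true h, one_mul, sub_zero, productMean.mul_prod hw1 (star i), mul_comm]
      · exact mul_le_mul_of_nonneg_left h1 (hnn j j')
      · intro ω ω' hω
        simp only [hF, size_congr_of_agree hω]
  refine le_trans ?_ (Finset.sum_le_sum fun j _ => Finset.sum_le_sum fun j' _ => key j j')
  simp only [← Finset.mul_sum, Finset.sum_sub_distrib]
  have hc0 : 0 ≤ c := by
    refine mul_nonneg (sq_nonneg _) (pow_nonneg ?_ _)
    have : p ≤ 1 := by
      rw [← hp, ← hw1]
      exact Finset.sum_le_sum fun a _ => mul_le_of_le_one_right (hw a) (oneIf_le_one _)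
    linarith
  refine mul_le_mul_of_nonneg_left ?_ hc0
  have h2 : ∑ j ∈ S, ∑ j' ∈ S, productMean w (fun ω => F j ω * F j' ω) =
      productMean w (fun ω => (∑ j ∈ S, F j ω) ^ 2) := by
    simp only [← productMean.sum, pow_two, Finset.sum_mul_sum]
  have h3 := productMean.sq_le hw hw1 (fun ω => ∑ j ∈ S, F j ω)
  rw [productMean.sum] at h3
  have h4 : (Fintype.card V - 1) * q ≤ ∑ j ∈ S, productMean w (F j) := by
    rw [← hcard, ← nsmul_eq_mul]
    exact Finset.card_nsmul_le_sum _ _ _ fun j hj => hq j (Finset.ne_of_mem_erase hj)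
  have h5 : 0 ≤ ((Fintype.card V : ℝ) - 1) * q := by
    rw [← hcard]; positivity
  have h6 := pow_le_pow_left₀ h5 h4 2
  have h7 : ∑ j ∈ S, ∑ j' ∈ S, (if j = j' then (1 : ℝ) else 0) ≤ Fintype.card V := by
    rw [Finset.sum_congr rfl fun j hj => by rw [Finset.sum_ite_eq, if_pos hj]]
    simp only [Finset.sum_const, nsmul_eq_mul, mul_one]
    linarith
  rw [h2]
  linarith

end randomGraph

/-! ### Concentration of the number of branching nodes. -/

namespace randomGraph

open SimpleGraph

variable {V α : Type*} [Fintype V] [DecidableEq V] [Fintype α] {w : α → ℝ} {b : α → Prop}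
  {r : V} {k : ℕ} {p μ : ℝ}

theorem openBall_compl_subset {i j : V} {ω : Sym2 V → α} (hij : (randomGraph b Set.univ ω).Adj i j)
    (k : ℕ) :
    (randomGraph b {i}ᶜ ω).openBall j k ⊆ (randomGraph b Set.univ ω).openBall i (k + 1) := by
  induction k with
  | zero => simp [openBall_zero]
  | succ k ih =>
    intro x hx
    rcases mem_openBall_succ.1 hx with rfl | ⟨u, hu, hux⟩
    · exact mem_openBall_succ_of_adj (root_mem_openBall k) hij
    · exact mem_openBall_succ_of_adj (ih hu) ⟨hux.1, trivial, trivial, hux.2.2.2⟩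

/-- The distances up to `k` in the branch at a neighbor `j` are decided by pairs with an endpoint at
distance less than `k` from `j`, hence at most `k` from `i`. -/
theorem Branching.of_agree {g : ℝ} {i : V} {e : Sym2 V} {ω ω' : Sym2 V → α}
    (he : ∀ x ∈ e, x ∉ (randomGraph b Set.univ ω).openBall i (k + 1))
    (h : ∀ e' ≠ e, ω e' = ω' e') (hω : Branching b k g i ω) : Branching b k g i ω' := by
  have hi (x : V) : s(i, x) ≠ e := by
    rintro rfl
    exact he i (Sym2.mem_mk_left i x) (root_mem_openBall k)
  have hsize {j : V} (hj : j ≠ i) (hb : b (ω s(i, j))) :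
      size b {i}ᶜ j k ω' = size b {i}ᶜ j k ω := by
    have hadj : (randomGraph b Set.univ ω).Adj i j := ⟨hj.symm, trivial, trivial, hb⟩
    have hF : ∀ e' ∈ ({e} : Finset (Sym2 V)), ∀ x ∈ e',
        x ∉ (randomGraph b {i}ᶜ ω).openBall j k := by
      intro e' he' x hx hxk
      rw [Finset.mem_singleton.1 he'] at hx
      exact he x hx (openBall_compl_subset hadj k hxk)
    have h' : ∀ e' ∉ ({e} : Finset (Sym2 V)), ω e' = ω' e' := fun e' he' =>
      h e' (by simpa using he')
    rw [size, size, sphere, sphere, openBall_congr_of_agree hF h' le_rfl,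
      openBall_congr_of_agree hF h' (Nat.le_succ k)]
  obtain ⟨j, j', hne, hji, hji', hb, hb', hg, hg'⟩ := hω
  exact ⟨j, j', hne, hji, hji', h _ (hi j) ▸ hb, h _ (hi j') ▸ hb', (hsize hji hb).symm ▸ hg,
    (hsize hji' hb').symm ▸ hg'⟩

theorem branching_congr {g : ℝ} {i : V} {ω ω' : Sym2 V → α} (h : ∀ e, b (ω e) ↔ b (ω' e)) :
    Branching b k g i ω ↔ Branching b k g i ω' := by
  have : randomGraph b {i}ᶜ ω = randomGraph b {i}ᶜ ω' := by
    ext u v; simp only [randomGraph, h]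
  simp only [Branching, size, this, h]

/-- The vertices at distance at most `k` from the endpoints of `e` once `e` has been deleted. -/
def nearEdge (b : α → Prop) (k : ℕ) (e : Sym2 V) (ω : Sym2 V → α) (i : V) : Prop :=
  ∃ x ∈ e, x ∈ ((randomGraph b Set.univ ω).deleteEdges {e}).openBall i (k + 1)

theorem deleteEdges_eq_of_not {e : Sym2 V} {ω : Sym2 V → α} (h : ¬ b (ω e)) :
    (randomGraph b Set.univ ω).deleteEdges {e} = randomGraph b Set.univ ω := by
  refine deleteEdges_eq_self.2 (Set.disjoint_singleton_right.2 fun he => ?_)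
  induction e with
  | h u v => exact h ((mem_edgeSet _).1 he).2.2.2

theorem deleteEdges_congr {e : Sym2 V} {ω ω' : Sym2 V → α} (h : ∀ e' ≠ e, ω e' = ω' e') :
    (randomGraph b Set.univ ω).deleteEdges {e} = (randomGraph b Set.univ ω').deleteEdges {e} := by
  ext u v
  simp only [deleteEdges_adj, Set.mem_singleton_iff]
  refine and_congr_left fun hne => ?_
  simp only [randomGraph, h _ hne]

/-- This is why `nearEdge` deletes `e`: the number of nodes near `e` becomes independent of the mark
of `e`. -/
theorem nearEdge_congr {e : Sym2 V} {ω ω' : Sym2 V → α} (h : ∀ e' ≠ e, ω e' = ω' e') :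
    nearEdge b k e ω = nearEdge b k e ω' := by
  funext i
  rw [nearEdge, nearEdge, deleteEdges_congr h]

/-- Start from the configuration in which `e` is absent, where deleting `e` changes nothing. If both
ends of `e` are far from `i` there, inserting `e` leaves the ball around `i` unchanged, so `e` is
invisible to `i` in both configurations. -/
theorem nearEdge_of_branching_ne {g : ℝ} {i : V} {e : Sym2 V} {ω ω' : Sym2 V → α}
    (h : ∀ e' ≠ e, ω e' = ω' e') (hne : ¬ (Branching b k g i ω ↔ Branching b k g i ω')) :
    ¬ (b (ω e) ↔ b (ω' e)) ∧ nearEdge b k e ω i := by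
  have h' : ∀ e' ≠ e, ω' e' = ω e' := fun e' he' => (h e' he').symm
  refine ⟨fun hb => hne (branching_congr fun e' => ?_), ?_⟩
  · rcases eq_or_ne e' e with rfl | he
    · exact hb
    · rw [h e' he]
  have key : ∀ {ω₁ ω₂ : Sym2 V → α}, (∀ e' ≠ e, ω₁ e' = ω₂ e') →
      ¬ (Branching b k g i ω₁ ↔ Branching b k g i ω₂) → ¬ b (ω₁ e) →
      nearEdge b k e ω₁ i := by
    intro ω₁ ω₂ h12 hne hb
    by_contra hnear
    rw [nearEdge, deleteEdges_eq_of_not hb] at hnear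
    push Not at hnear
    have hfar : ∀ x ∈ e, x ∉ (randomGraph b Set.univ ω₂).openBall i (k + 1) := by
      have : (randomGraph b Set.univ ω₂).openBall i (k + 1) =
          (randomGraph b Set.univ ω₁).openBall i (k + 1) := by
        refine openBall_congr_of_agree (F := {e}) (k := k + 1) ?_ ?_ (Nat.le_succ _)
        · intro e' he'
          rw [Finset.mem_singleton.1 he']
          exact hnear
        · intro e' he'
          exact h12 e' (by simpa using he')
      rw [this]
      exact hnear
    exact hne ⟨fun hY => hY.of_agree hnear h12,
      fun hY => hY.of_agree hfar fun e' he' => (h12 e' he').symm⟩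
  by_cases hb : b (ω e)
  · by_cases hb' : b (ω' e)
    · refine absurd (branching_congr fun e' => ?_) hne
      rcases eq_or_ne e' e with rfl | he
      · exact iff_of_true hb hb'
      · rw [h e' he]
    · rw [nearEdge_congr h]
      exact key h' (fun hY => hne hY.symm) hb'
  · exact key h hne hb

/-- The number of vertices near the edge `e`. -/
noncomputable def edgeVolume (b : α → Prop) (k : ℕ) (e : Sym2 V) (ω : Sym2 V → α) : ℝ :=
  ∑ i : V, oneIf (nearEdge b k e ω i)

theorem edgeVolume_nonneg (e : Sym2 V) (ω : Sym2 V → α) : 0 ≤ edgeVolume b k e ω :=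
  Finset.sum_nonneg fun _ _ => oneIf_nonneg _

theorem edgeVolume_le (x y : V) (ω : Sym2 V → α) :
    edgeVolume b k s(x, y) ω ≤ volume b Set.univ x (k + 1) ω + volume b Set.univ y (k + 1) ω := by
  rw [edgeVolume, volume, volume, card_eq_sum_oneIf, card_eq_sum_oneIf, ← Finset.sum_add_distrib]
  refine Finset.sum_le_sum fun i _ => ?_
  by_cases h : nearEdge b k s(x, y) ω i
  · obtain ⟨z, hz, hzi⟩ := h
    have h1 := mem_openBall_comm.1 (openBall_mono_left (deleteEdges_le _) _ hzi)
    have h2 := oneIf_le_one (nearEdge b k s(x, y) ω i)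
    rcases Sym2.mem_iff.1 hz with rfl | rfl
    · rw [oneIf_true h1]
      exact h2.trans (le_add_of_nonneg_right (oneIf_nonneg _))
    · rw [oneIf_true h1]
      exact h2.trans (le_add_of_nonneg_left (oneIf_nonneg _))
  · rw [oneIf_false h]
    exact add_nonneg (oneIf_nonneg _) (oneIf_nonneg _)

theorem mean_edgeVolume_sq_le (hw : ∀ a, 0 ≤ w a) {M : ℝ}
    (hM : ∀ x : V, productMean w (fun ω => volume b Set.univ x (k + 1) ω ^ 2) ≤ M) (e : Sym2 V) :
    productMean w (fun ω => edgeVolume b k e ω ^ 2) ≤ 4 * M := by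
  induction e with
  | h x y =>
    have h1 (ω : Sym2 V → α) : edgeVolume b k s(x, y) ω ^ 2 ≤
        2 * volume b Set.univ x (k + 1) ω ^ 2 + 2 * volume b Set.univ y (k + 1) ω ^ 2 := by
      have := pow_le_pow_left₀ (edgeVolume_nonneg _ _) (edgeVolume_le (b := b) (k := k) x y ω) 2
      nlinarith [sq_nonneg (volume b Set.univ x (k + 1) ω - volume b Set.univ y (k + 1) ω)]
    refine (productMean.mono hw h1).trans ?_
    rw [productMean.add, productMean.const_mul, productMean.const_mul]
    linarith [hM x, hM y]

theorem abs_sum_branching_sub_le {g : ℝ} {e : Sym2 V} {ω ω' : Sym2 V → α}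
    (h : ∀ e' ≠ e, ω e' = ω' e') :
    |∑ i : V, oneIf (Branching b k g i ω) - ∑ i : V, oneIf (Branching b k g i ω')| ≤
      oneIf (¬ (b (ω e) ↔ b (ω' e))) * edgeVolume b k e ω := by
  rw [← Finset.sum_sub_distrib, edgeVolume, Finset.mul_sum]
  refine (Finset.abs_sum_le_sum_abs _ _).trans (Finset.sum_le_sum fun i _ => ?_)
  by_cases hY : Branching b k g i ω ↔ Branching b k g i ω'
  · rw [propext hY, sub_self, abs_zero]
    exact mul_nonneg (oneIf_nonneg _) (oneIf_nonneg _)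
  · obtain ⟨h1, h2⟩ := nearEdge_of_branching_ne h hY
    rw [oneIf_true h1, oneIf_true h2, mul_one, abs_le]
    constructor <;> linarith [oneIf_le_one (Branching b k g i ω), oneIf_nonneg (Branching b k g i ω),
      oneIf_le_one (Branching b k g i ω'), oneIf_nonneg (Branching b k g i ω')]

theorem card_sym2_le : (Fintype.card (Sym2 V) : ℝ) ≤ (Fintype.card V : ℝ) ^ 2 := by
  have : Fintype.card (Sym2 V) ≤ Fintype.card (V × V) :=
    Fintype.card_le_of_surjective (fun x : V × V => s(x.1, x.2)) fun e => by
      induction e with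
      | h x y => exact ⟨(x, y), rfl⟩
  rw [Fintype.card_prod, ← pow_two] at this
  exact_mod_cast this

/-- Efron–Stein: resampling `e` matters only if `e` is present before or after, which costs `2 * p`,
and then moves the sum by at most `edgeVolume`, whose independent second moment is at most `4 * M`.
There are at most `|V|²` pairs. -/
theorem variance_sum_branching_le (hw : ∀ a, 0 ≤ w a) (hw1 : ∑ a, w a = 1)
    (hp : ∑ a, w a * oneIf (b a) = p) (g : ℝ) {M : ℝ}
    (hM : ∀ x : V, productMean w (fun ω => volume b Set.univ x (k + 1) ω ^ 2) ≤ M) (hM0 : 0 ≤ M) :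
    productMean w (fun ω => (∑ i : V, oneIf (Branching b k g i ω) -
      productMean w (fun ω => ∑ i : V, oneIf (Branching b k g i ω))) ^ 2) ≤
      8 * p * M * Fintype.card V ^ 2 := by
  have hp0 := prob_nonneg hw hp
  refine (productMean.variance_le hw hw1 _).trans ?_
  have key (e : Sym2 V) : productMean w (fun ω => ∑ a, w a *
      (∑ i : V, oneIf (Branching b k g i ω) -
        ∑ i : V, oneIf (Branching b k g i (Function.update ω e a))) ^ 2) ≤ 8 * p * M := by
    have h1 (ω : Sym2 V → α) : ∑ a, w a *
      (∑ i : V, oneIf (Branching b k g i ω) -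
        ∑ i : V, oneIf (Branching b k g i (Function.update ω e a))) ^ 2 ≤
        edgeVolume b k e ω ^ 2 * oneIf (b (ω e)) + p * edgeVolume b k e ω ^ 2 := by
      have h2 (a : α) : (∑ i : V, oneIf (Branching b k g i ω) -
          ∑ i : V, oneIf (Branching b k g i (Function.update ω e a))) ^ 2 ≤
          oneIf (b (ω e)) * edgeVolume b k e ω ^ 2 + oneIf (b a) * edgeVolume b k e ω ^ 2 := by
        have h3 := abs_sum_branching_sub_le (b := b) (k := k) (g := g) (e := e) (ω := ω)
          (ω' := Function.update ω e a) fun e' he' => (Function.update_of_ne he' _ _).symm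
        rw [Function.update_self] at h3
        have h4 := pow_le_pow_left₀ (abs_nonneg _) h3 2
        rw [sq_abs, mul_pow, oneIf_sq] at h4
        refine h4.trans ?_
        rw [← add_mul]
        refine mul_le_mul_of_nonneg_right ?_ (sq_nonneg _)
        by_cases hb : b (ω e) <;> by_cases hba : b a <;> simp [oneIf, hb, hba]
      refine (Finset.sum_le_sum fun a _ => mul_le_mul_of_nonneg_left (h2 a) (hw a)).trans
        (le_of_eq ?_)
      simp only [mul_add, Finset.sum_add_distrib, ← mul_assoc, ← Finset.sum_mul, hw1, hp]
      ring
    refine (productMean.mono hw h1).trans ?_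
    have h5 := productMean.mul_prod hw1 {e} (fun ω => edgeVolume b k e ω ^ 2)
      (fun ω ω' h => by
        simp only [edgeVolume, nearEdge_congr (b := b) (k := k) fun e' he' =>
          h e' (by simpa using he')]) (fun _ a => oneIf (b a))
    simp only [Finset.prod_singleton, hp] at h5
    rw [productMean.add, productMean.const_mul, h5]
    have h6 := mul_le_mul_of_nonneg_left (mean_edgeVolume_sq_le hw hM e) hp0
    linarith
  refine (Finset.sum_le_sum fun e _ => key e).trans ?_
  rw [Finset.sum_const, nsmul_eq_mul, mul_comm, Finset.card_univ]
  exact mul_le_mul_of_nonneg_left card_sym2_le (mul_nonneg (by linarith) hM0)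

end randomGraph

/-! ### Deterministic part: acyclic balls and the common tree. -/

namespace SimpleGraph

section Acyclic

variable {V : Type*} [Fintype V] [DecidableEq V] {G : SimpleGraph V} {r u v : V}

theorem mem_sphere_iff_edist {k : ℕ} : v ∈ G.sphere r k ↔ G.edist r v = k := by
  rw [mem_sphere, mem_openBall, mem_openBall, not_lt, Nat.cast_add, Nat.cast_one,
    ENat.lt_add_one_iff (ENat.natCast_ne_top k)]
  exact ⟨fun h => le_antisymm h.1 h.2, fun h => ⟨h.le, h.ge⟩⟩

theorem le_succ_of_adj_sphere {j k : ℕ} (hu : u ∈ G.sphere r j) (hv : v ∈ G.sphere r k)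
    (h : G.Adj u v) : k ≤ j + 1 := by
  by_contra hlt
  exact (mem_sphere.1 hv).2
    (openBall_mono (by omega) (mem_openBall_succ_of_adj (sphere_subset j hu) h))

/-- A ball has no cycle if no two vertices at the same distance from the center are adjacent and
no vertex has two neighbors that are closer to the center. -/
theorem noCycleInBall_of_sphere {d : ℕ}
    (h1 : ∀ k ≤ d, ∀ u ∈ G.sphere r k, ∀ v ∈ G.sphere r k, ¬ G.Adj u v)
    (h2 : ∀ k < d, ∀ v ∈ G.sphere r (k + 1), ∀ u ∈ G.sphere r k, ∀ u' ∈ G.sphere r k,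
      G.Adj u v → G.Adj u' v → u = u') : G.NoCycleInBall r d := by
  classical
  intro x c hc
  have hlevel (y : G.closedBall r d) : ∃ k ≤ d, (y : V) ∈ G.sphere r k := by
    have hy : G.edist r y ≤ d := y.2
    obtain ⟨k, hk⟩ := ENat.ne_top_iff_exists.1 (ne_top_of_le_ne_top (ENat.natCast_ne_top d) hy)
    exact ⟨k, by rw [← hk] at hy; exact_mod_cast hy, mem_sphere_iff_edist.2 hk.symm⟩
  choose l hld hl using hlevel
  -- Start the cycle at a vertex farthest from the center. Its two neighbors along the cycle are
  -- distinct and, levels being free of edges, both are exactly one step closer to the center.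
  obtain ⟨y, hy, hmax⟩ := c.support.toFinset.exists_max_image l
    ⟨x, List.mem_toFinset.2 c.start_mem_support⟩
  rw [List.mem_toFinset] at hy
  have hc' := (Walk.isCycle_rotate hy).2 hc
  set c' := c.rotate y hy with hc'_def
  have hsupp (z : G.closedBall r d) (hz : z ∈ c'.support) : l z ≤ l y := by
    refine hmax z (List.mem_toFinset.2 ?_)
    exact (Walk.mem_support_rotate_iff c y hy).1 hz
  have hnil : ¬ c'.Nil := hc'.not_nil
  have ha1 : G.Adj y c'.snd := c'.adj_snd hnil
  have ha2 : G.Adj c'.penultimate y := c'.adj_penultimate hnil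
  have hs1 := hsupp _ (c'.getVert_mem_support 1)
  have hs2 := hsupp _ (c'.getVert_mem_support (c'.length - 1))
  have key (z : G.closedBall r d) (hz : l z ≤ l y) (hadj : G.Adj z y) : l z + 1 = l y := by
    have := le_succ_of_adj_sphere (hl z) (hl y) hadj
    have hne : l z ≠ l y := fun he => h1 _ (hld y) _ (he ▸ hl z) _ (hl y) hadj
    omega
  have k1 := key _ hs1 ha1.symm
  have k2 := key _ hs2 ha2
  refine hc'.snd_ne_penultimate (Subtype.ext ?_)
  have hly := hl y
  rw [← k1] at hly
  have hp := hl c'.penultimate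
  rw [show l c'.penultimate = l c'.snd from by
    have : l c'.penultimate + 1 = l y := k2
    have : l c'.snd + 1 = l y := k1
    omega] at hp
  refine h2 (l c'.snd) ?_ y hly _ (hl c'.snd) _ hp ha1.symm ha2
  have := hld y
  have : l c'.snd + 1 = l y := k1
  omega

end Acyclic

theorem IsAcyclic.dist_eq_length {V : Type*} {G : SimpleGraph V} (hG : G.IsAcyclic) {u v : V}
    {p : G.Walk u v} (hp : p.IsPath) : G.dist u v = p.length := by
  obtain ⟨q, hq, hql⟩ := p.reachable.exists_path_of_dist
  rw [← hql]
  have := hG.subsingleton_path u v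
  exact congrArg (fun x : G.Path u v => x.1.length) (Subsingleton.elim ⟨q, hq⟩ ⟨p, hp⟩)

section Branch

variable {V : Type*} {G H : SimpleGraph V} {i j : V} {N : ℕ}

theorem deleteIncidenceSet_mono (h : H ≤ G) (i : V) :
    H.deleteIncidenceSet i ≤ G.deleteIncidenceSet i := fun u v huv => by
  rw [deleteIncidenceSet_adj] at huv ⊢
  exact ⟨h huv.1, huv.2⟩

theorem isAcyclic_branch (hij : G.Adj i j) (h : G.NoCycleInBall i (N + 1)) :
    (G.branch N j i).graph.IsAcyclic := by
  have hsub : G.branchVerts N j i ⊆ G.closedBall i (N + 1) := by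
    intro x hx
    have h1 : G.edist j x ≤ N := (edist_anti (G.deleteIncidenceSet_le i)).trans hx
    have h2 : G.edist i j = 1 := edist_eq_one_iff_adj.2 hij
    calc G.edist i x ≤ G.edist i j + G.edist j x := SimpleGraph.edist_triangle
      _ ≤ 1 + N := by rw [h2]; gcongr
      _ = ((N + 1 : ℕ) : ℕ∞) := by push_cast; ring
  exact h.comap (G.induceHomOfLE hsub).toHom (G.induceHomOfLE hsub).injective

/-- The vertices on paths of length `N` from `j` that avoid `i`. -/
def pathVerts (H : SimpleGraph V) (N : ℕ) (j i : V) : Set V :=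
  {x | ∃ (v : V) (q : (H.deleteIncidenceSet i).Walk j v), q.IsPath ∧ q.length = N ∧ x ∈ q.support}

theorem pathVerts_subset (h : H ≤ G) (N : ℕ) (j i : V) :
    H.pathVerts N j i ⊆ G.branchVerts N j i := by
  classical
  rintro x ⟨v, q, -, hq, hx⟩
  have h1 : (H.deleteIncidenceSet i).edist j x ≤ N :=
    (edist_le (q.takeUntil x hx)).trans (by
      have := q.length_takeUntil_le_length hx
      exact_mod_cast this.trans hq.le)
  exact (edist_anti (deleteIncidenceSet_mono h i)).trans h1

/-- The graph formed by the paths of length `N` from `j` that avoid `i`. -/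
def pathBranch (H : SimpleGraph V) (N : ℕ) (j i : V) (hj : j ∈ H.pathVerts N j i) :
    RootedGraph (H.pathVerts N j i) where
  graph := (H.deleteIncidenceSet i).induce (H.pathVerts N j i)
  root := ⟨j, hj⟩

/-- The inclusion of the graph of paths into the branch of a larger graph. -/
def pathBranchHom (h : H ≤ G) (hj : j ∈ H.pathVerts N j i) :
    (H.pathBranch N j i hj).graph →g (G.branch N j i).graph where
  toFun := Set.inclusion (pathVerts_subset h N j i)
  map_rel' := fun huv => h (H.deleteIncidenceSet_le i huv)

theorem pathBranchHom_injective (h : H ≤ G) (hj : j ∈ H.pathVerts N j i) :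
    Function.Injective (pathBranchHom h hj) :=
  Set.inclusion_injective (pathVerts_subset h N j i)

theorem connected_pathBranch (hj : j ∈ H.pathVerts N j i) :
    (H.pathBranch N j i hj).graph.Connected := by
  classical
  refine connected_iff_exists_forall_reachable _ |>.2 ⟨⟨j, hj⟩, ?_⟩
  rintro ⟨x, hx⟩
  obtain ⟨v, q, hq, hN, hxq⟩ := id hx
  have hsub : ∀ y ∈ (q.takeUntil x hxq).support, y ∈ H.pathVerts N j i := fun y hy =>
    ⟨v, q, hq, hN, q.support_takeUntil_subset_support hxq hy⟩
  exact ⟨(q.takeUntil x hxq).induce _ hsub⟩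

theorem depth_pathBranch (hj : j ∈ H.pathVerts N j i)
    (hac : (H.pathBranch N j i hj).graph.IsAcyclic) {v : V}
    (q : (H.deleteIncidenceSet i).Walk j v) (hq : q.IsPath) (hN : q.length = N) {m : ℕ}
    (hm : m ≤ N) (hmem : q.getVert m ∈ H.pathVerts N j i) :
    (H.pathBranch N j i hj).depth ⟨q.getVert m, hmem⟩ = m := by
  have hsub : ∀ y ∈ (q.take m).support, y ∈ H.pathVerts N j i := fun y hy =>
    ⟨v, q, hq, hN, (q.isSubwalk_take m).support_subset hy⟩
  have hpath : ((q.take m).induce _ hsub).IsPath := by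
    refine Walk.IsPath.of_map (f := (Embedding.induce _).toHom) ?_
    rw [Walk.map_induce]
    exact hq.take m
  have h1 : (H.pathBranch N j i hj).depth ⟨q.getVert m, hmem⟩ =
      ((q.take m).induce _ hsub).length := hac.dist_eq_length hpath
  have h2 : ((q.take m).induce _ hsub).length = (q.take m).length := by
    rw [← Walk.length_map (Embedding.induce _).toHom, Walk.map_induce]
    rfl
  rw [h1, h2, Walk.take_length]
  omega

/-- Keeping only the vertices on paths of full length `N` prunes the dead ends: a kept vertex at
depth `m < N` has the next vertex of its path as a child. -/
theorem isTreeWithLeavesAt_pathBranch (hj : j ∈ H.pathVerts N j i)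
    (hac : (H.pathBranch N j i hj).graph.IsAcyclic) :
    (H.pathBranch N j i hj).IsTreeWithLeavesAt N := by
  refine ⟨⟨connected_pathBranch hj, hac⟩, ?_⟩
  rintro ⟨x, hx⟩ hleaf
  obtain ⟨v, q, hq, hN, hxq⟩ := id hx
  obtain ⟨m, rfl, hm⟩ := Walk.mem_support_iff_exists_getVert.1 hxq
  rw [hN] at hm
  rw [depth_pathBranch hj hac q hq hN hm]
  by_contra hne
  have hlt : m < N := lt_of_le_of_ne hm hne
  have hy : q.getVert (m + 1) ∈ H.pathVerts N j i :=
    ⟨v, q, hq, hN, q.getVert_mem_support _⟩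
  refine hleaf ⟨_, hy⟩ ⟨q.adj_getVert_succ (by omega), ?_⟩
  rw [depth_pathBranch hj hac q hq hN hm, depth_pathBranch hj hac q hq hN hlt]

/-- The inclusion keeps depths, although distances could shrink in a larger graph: it maps paths to
paths, and in an acyclic graph the length of a path is the distance of its ends. -/
theorem isEmbedding_pathBranchHom (h : H ≤ G) (hij : G.Adj i j)
    (hG : G.NoCycleInBall i (N + 1)) (hj : j ∈ H.pathVerts N j i) :
    (H.pathBranch N j i hj).IsEmbedding (G.branch N j i) (pathBranchHom h hj) := by
  refine ⟨pathBranchHom_injective h hj, rfl, fun p v hpv => ⟨(pathBranchHom h hj).map_rel hpv.1, ?_⟩⟩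
  have key (x) : (G.branch N j i).depth (pathBranchHom h hj x) =
      (H.pathBranch N j i hj).depth x := by
    obtain ⟨q, hq, hql⟩ := (connected_pathBranch hj).exists_path_of_dist
      (H.pathBranch N j i hj).root x
    have := (isAcyclic_branch hij hG).dist_eq_length
      (hq.map (pathBranchHom_injective h hj))
    rw [Walk.length_map, hql] at this
    exact this
  rw [key, key, hpv.2]

end Branch

/-- The vertices at distance `N` from `j` in a common subgraph are leaves of a common tree. -/
theorem card_sphere_le_edgeWeight {V : Type} [Fintype V] [DecidableEq V]
    {G₁ G₂ H : SimpleGraph V} (h₁ : H ≤ G₁) (h₂ : H ≤ G₂) {i j : V} {N : ℕ} (hij : H.Adj i j)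
    (hac₁ : G₁.NoCycleInBall i (N + 1)) (hac₂ : G₂.NoCycleInBall i (N + 1)) :
    ((H.deleteIncidenceSet i).sphere j N).card ≤ edgeWeight G₁ G₂ N j i j i := by
  -- With an empty sphere there may be no path of length `N` from `j`, hence no root for the common
  -- tree.
  rcases ((H.deleteIncidenceSet i).sphere j N).eq_empty_or_nonempty with hem | ⟨v₀, hv₀⟩
  · rw [hem, Finset.card_empty]; exact Nat.zero_le _
  have hpath {v : V} (hv : v ∈ (H.deleteIncidenceSet i).sphere j N) :
      ∃ q : (H.deleteIncidenceSet i).Walk j v, q.IsPath ∧ q.length = N := by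
    have hv' := mem_sphere_iff_edist.1 hv
    obtain ⟨q, hq⟩ := exists_walk_of_edist_eq_coe hv'
    refine ⟨q, q.isPath_of_length_eq_dist ?_, hq⟩
    rw [hq, dist, hv']; rfl
  have hj : j ∈ H.pathVerts N j i := by
    obtain ⟨q, hq, hN⟩ := hpath hv₀
    exact ⟨v₀, q, hq, hN, q.start_mem_support⟩
  have hac : (H.pathBranch N j i hj).graph.IsAcyclic :=
    (isAcyclic_branch (h₁ hij) hac₁).comap _ (pathBranchHom_injective h₁ hj)
  have hmem : ((H.pathBranch N j i hj).level N).ncard ∈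
      (G₁.branch N j i).commonLeafCounts (G₂.branch N j i) N :=
    ⟨_, _, isTreeWithLeavesAt_pathBranch hj hac,
      ⟨_, isEmbedding_pathBranchHom h₁ (h₁ hij) hac₁ hj⟩,
      ⟨_, isEmbedding_pathBranchHom h₂ (h₂ hij) hac₂ hj⟩, rfl⟩
  refine le_trans ?_ (le_csSup (RootedGraph.bddAbove_commonLeafCounts _ _ _) hmem)
  rw [← Set.ncard_image_of_injective _ Subtype.val_injective, ← Set.ncard_coe_finset]
  refine Set.ncard_le_ncard ?_ (Set.toFinite _)
  intro v hv
  obtain ⟨q, hq, hN⟩ := hpath hv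
  have hvN : q.getVert N = v := by rw [← hN, q.getVert_length]
  have hmemv : q.getVert N ∈ H.pathVerts N j i := ⟨v, q, hq, hN, q.getVert_mem_support _⟩
  exact ⟨⟨q.getVert N, hmemv⟩, depth_pathBranch hj hac q hq hN le_rfl hmemv, hvN⟩

theorem NoCycleInBall.anti {V : Type*} {G U : SimpleGraph V} (h : G ≤ U) {r : V} {d : ℕ}
    (hU : U.NoCycleInBall r d) : G.NoCycleInBall r d := by
  have hsub : G.closedBall r d ⊆ U.closedBall r d := fun x hx => (edist_anti h).trans hx
  let f : G.induce (G.closedBall r d) →g U.induce (U.closedBall r d) :=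
    ⟨Set.inclusion hsub, fun huv => h huv⟩
  exact hU.comap f (Set.inclusion_injective hsub)

end SimpleGraph

/-! ### Balls of the random graph have few cycles. -/

namespace randomGraph

open SimpleGraph

variable {V α : Type*} [Fintype V] [DecidableEq V] [Fintype α] {w : α → ℝ} {b : α → Prop}
  {r : V} {p μ : ℝ}

/-- An upper bound for the indicator of a cycle at distance at most `d` from `r`. -/
noncomputable def excess (b : α → Prop) (r : V) (d : ℕ) (ω : Sym2 V → α) : ℝ :=
  ∑ k ∈ Finset.range (d + 1), (levelEdges b Set.univ r k ω + collisions b Set.univ r k ω)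

theorem levelEdges_nonneg (k : ℕ) (ω : Sym2 V → α) : 0 ≤ levelEdges b Set.univ r k ω :=
  Finset.sum_nonneg fun _ _ => Finset.sum_nonneg fun _ _ =>
    mul_nonneg (oneIf_nonneg _) (oneIf_nonneg _)

theorem collisions_nonneg (k : ℕ) (ω : Sym2 V → α) : 0 ≤ collisions b Set.univ r k ω :=
  Finset.sum_nonneg fun _ _ => Finset.sum_nonneg fun _ _ => Finset.sum_nonneg fun _ _ =>
    mul_nonneg (oneIf_nonneg _) (mul_nonneg (crossing_nonneg _ _ _) (crossing_nonneg _ _ _))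

theorem excess_nonneg (d : ℕ) (ω : Sym2 V → α) : 0 ≤ excess b r d ω :=
  Finset.sum_nonneg fun k _ => add_nonneg (levelEdges_nonneg k ω) (collisions_nonneg k ω)

/-- `excess` counts the two obstructions of `noCycleInBall_of_sphere`, and a single occurrence of
either already contributes `1`. -/
theorem noCycleInBall_of_excess_lt {d : ℕ} {ω : Sym2 V → α} (h : excess b r d ω < 1) :
    (randomGraph b Set.univ ω).NoCycleInBall r d := by
  have hterm {k : ℕ} (hk : k ≤ d) :
      levelEdges b Set.univ r k ω + collisions b Set.univ r k ω < 1 :=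
    (Finset.single_le_sum (f := fun k => levelEdges b Set.univ r k ω + collisions b Set.univ r k ω)
      (fun k _ => add_nonneg (levelEdges_nonneg k ω) (collisions_nonneg k ω))
      (Finset.mem_range.2 (Nat.lt_succ_of_le hk))).trans_lt h
  refine noCycleInBall_of_sphere ?_ ?_
  · intro k hk u hu v hv huv
    have h1 : 1 ≤ levelEdges b Set.univ r k ω := by
      have hf : Frontier b Set.univ r k {u, v} ∅ ω :=
        ⟨by simp [Finset.insert_subset_iff, hu, hv], by simp⟩
      calc (1 : ℝ) = oneIf (Frontier b Set.univ r k {u, v} ∅ ω) * oneIf (b (ω s(u, v))) := by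
            rw [oneIf_true hf, oneIf_true huv.2.2.2, one_mul]
        _ ≤ ∑ v', oneIf (Frontier b Set.univ r k {u, v'} ∅ ω) * oneIf (b (ω s(u, v'))) :=
            Finset.single_le_sum (f := fun v' =>
              oneIf (Frontier b Set.univ r k {u, v'} ∅ ω) * oneIf (b (ω s(u, v'))))
              (fun _ _ => mul_nonneg (oneIf_nonneg _) (oneIf_nonneg _)) (Finset.mem_univ v)
        _ ≤ levelEdges b Set.univ r k ω :=
            Finset.single_le_sum (f := fun u' => ∑ v',
              oneIf (Frontier b Set.univ r k {u', v'} ∅ ω) * oneIf (b (ω s(u', v'))))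
              (fun _ _ => Finset.sum_nonneg fun _ _ => mul_nonneg (oneIf_nonneg _)
                (oneIf_nonneg _)) (Finset.mem_univ u)
    linarith [hterm hk, collisions_nonneg (b := b) (r := r) k ω]
  · intro k hk v hv u hu u' hu' huv huv'
    by_contra hne
    have hv' := (mem_sphere.1 hv).2
    have hcr {x : V} (hx : x ∈ (randomGraph b Set.univ ω).sphere r k)
        (hxv : (randomGraph b Set.univ ω).Adj x v) : crossing b Set.univ r k ω x v = 1 := by
      rw [crossing, oneIf_true (frontier_singleton.2 ⟨hx, hv'⟩), oneIf_true hxv.2.2.2, one_mul]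
    have hnn (v x x' : V) : 0 ≤ oneIf (x ≠ x') *
        (crossing b Set.univ r k ω x v * crossing b Set.univ r k ω x' v) :=
      mul_nonneg (oneIf_nonneg _) (mul_nonneg (crossing_nonneg _ _ _) (crossing_nonneg _ _ _))
    have h1 : 1 ≤ collisions b Set.univ r k ω := by
      calc (1 : ℝ) = oneIf (u ≠ u') *
            (crossing b Set.univ r k ω u v * crossing b Set.univ r k ω u' v) := by
            rw [hcr hu huv, hcr hu' huv', oneIf_true hne, one_mul, one_mul]
        _ ≤ ∑ x', oneIf (u ≠ x') *
            (crossing b Set.univ r k ω u v * crossing b Set.univ r k ω x' v) :=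
            Finset.single_le_sum (f := fun x' => oneIf (u ≠ x') *
              (crossing b Set.univ r k ω u v * crossing b Set.univ r k ω x' v))
              (fun _ _ => hnn _ _ _) (Finset.mem_univ u')
        _ ≤ ∑ x, ∑ x', oneIf (x ≠ x') *
            (crossing b Set.univ r k ω x v * crossing b Set.univ r k ω x' v) :=
            Finset.single_le_sum (f := fun x => ∑ x', oneIf (x ≠ x') *
              (crossing b Set.univ r k ω x v * crossing b Set.univ r k ω x' v))
              (fun _ _ => Finset.sum_nonneg fun _ _ => hnn _ _ _) (Finset.mem_univ u)
        _ ≤ collisions b Set.univ r k ω :=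
            Finset.single_le_sum (f := fun v => ∑ x, ∑ x', oneIf (x ≠ x') *
              (crossing b Set.univ r k ω x v * crossing b Set.univ r k ω x' v))
              (fun _ _ => Finset.sum_nonneg fun _ _ => Finset.sum_nonneg fun _ _ => hnn _ _ _)
              (Finset.mem_univ v)
    linarith [hterm hk.le, levelEdges_nonneg (b := b) (r := r) k ω]

/-- On each level, edges inside the sphere cost `p` and collisions cost `p² |V| = p μ` times the
second moment of the sphere. For `p` of order `1 / n` the bound is small once `μ^(2d)` times `d` is
far below `n`. -/
theorem mean_excess_le (hw : ∀ a, 0 ≤ w a) (hw1 : ∑ a, w a = 1)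
    (hp : ∑ a, w a * oneIf (b a) = p) (hμ : p * Fintype.card V = μ) (hμ1 : 1 < μ) (d : ℕ) :
    productMean w (excess b r d) ≤ (d + 1) * (p * (1 + μ) * (μ / (μ - 1) * μ ^ (2 * d))) := by
  have hp0 := prob_nonneg hw hp
  unfold excess
  rw [productMean.sum]
  have key : ∀ k ∈ Finset.range (d + 1), productMean w (fun ω =>
      levelEdges b Set.univ r k ω + collisions b Set.univ r k ω) ≤
      p * (1 + μ) * (μ / (μ - 1) * μ ^ (2 * d)) := by
    intro k hk
    rw [productMean.add]
    have h1 := mean_levelEdges_le (b := b) (A := Set.univ) (r := r) (k := k) hw hw1 hp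
    have h2 := mean_collisions_le (b := b) (A := Set.univ) (r := r) (k := k) hw hw1 hp
    have h3 := mean_size_sq_le (b := b) (A := Set.univ) (r := r) hw hw1 hp hμ hμ1 k
    have h4 : μ / (μ - 1) * μ ^ (2 * k) ≤ μ / (μ - 1) * μ ^ (2 * d) :=
      mul_le_mul_of_nonneg_left (pow_le_pow_right₀ hμ1.le (by
        have := Finset.mem_range.1 hk; omega)) (div_nonneg (by linarith) (by linarith))
    have h5 := mul_le_mul_of_nonneg_left (h3.trans h4) (show 0 ≤ p * (1 + μ) from
      mul_nonneg hp0 (by linarith))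
    have h6 : p ^ 2 * Fintype.card V = p * μ := by rw [← hμ]; ring
    rw [h6] at h2
    refine le_trans ?_ h5
    have := add_le_add h1 h2
    refine this.trans (le_of_eq (by ring))
  refine (Finset.sum_le_sum key).trans (le_of_eq ?_)
  rw [Finset.sum_const, Finset.card_range, nsmul_eq_mul]
  push_cast
  ring

end randomGraph

/-! ### The correlated model as a finite product of marks. -/

/-- The probabilities of the four marks of a pair of nodes. -/
def markWeight (p s : ℝ) : Bool × Bool → ℝ
  | (true, true) => p * s
  | (true, false) => p * (1 - s)
  | (false, true) => p * (1 - s)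
  | (false, false) => 1 - p * (2 - s)

theorem markWeight_nonneg {p s : ℝ} (hp : 0 ≤ p) (hs : s ∈ Set.Icc (0 : ℝ) 1)
    (hps : p * (2 - s) ≤ 1) : ∀ a, 0 ≤ markWeight p s a
  | (true, true) => mul_nonneg hp hs.1
  | (true, false) => mul_nonneg hp (by linarith [hs.2])
  | (false, true) => mul_nonneg hp (by linarith [hs.2])
  | (false, false) => by simp only [markWeight]; linarith

theorem sum_markWeight (p s : ℝ) : ∑ a, markWeight p s a = 1 := by
  simp [Fintype.sum_prod_type, markWeight]
  ring

/-- The pair is an edge of both graphs. -/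
def InBoth (a : Bool × Bool) : Prop := a.1 = true ∧ a.2 = true

/-- The pair is an edge of one of the graphs. -/
def InEither (a : Bool × Bool) : Prop := a.1 = true ∨ a.2 = true

theorem sum_markWeight_inBoth (p s : ℝ) : ∑ a, markWeight p s a * oneIf (InBoth a) = p * s := by
  simp [Fintype.sum_prod_type, markWeight, InBoth, oneIf]

theorem sum_markWeight_inEither (p s : ℝ) :
    ∑ a, markWeight p s a * oneIf (InEither a) = p * (2 - s) := by
  simp [Fintype.sum_prod_type, markWeight, InEither, oneIf]
  ring

theorem pairLaw_singleton (p s : ℝ) (a : Bool × Bool) :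
    pairLaw p s {a} = ENNReal.ofReal (markWeight p s a) := by
  rcases a with ⟨_ | _, _ | _⟩ <;>
    simp [pairLaw, markWeight]

theorem measurableSingletonClass_simpleGraph {V : Type*} [Countable V] :
    MeasurableSingletonClass (SimpleGraph V) where
  measurableSet_singleton G := by
    refine ⟨{G.Adj}, measurableSet_singleton _, ?_⟩
    ext G'
    exact SimpleGraph.ext_iff.symm

theorem ERC_eq_ofReal {n : ℕ} {p s : ℝ} (hp : 0 ≤ p) (hs : s ∈ Set.Icc (0 : ℝ) 1)
    (hps : p * (2 - s) ≤ 1) (S : Set (SimpleGraph (Fin n) × SimpleGraph (Fin n))) :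
    ERC n p s S = ENNReal.ofReal
      (productMean (markWeight p s) fun ω => oneIf (graphPair ω ∈ S)) := by
  classical
  have : MeasurableSingletonClass (SimpleGraph (Fin n)) := measurableSingletonClass_simpleGraph
  have hprob := isProbabilityMeasure_pairLaw hp hs hps
  have hw := markWeight_nonneg hp hs hps
  rw [ERC, Measure.map_apply measurable_graphPair (Set.toFinite S).measurableSet,
    ← Set.coe_toFinset (graphPair ⁻¹' S), ← sum_measure_singleton, productMean,
    ENNReal.ofReal_sum_of_nonneg fun ω _ =>
      mul_nonneg (Finset.prod_nonneg fun e _ => hw _) (oneIf_nonneg _),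
    ← Finset.sum_subset (Finset.subset_univ (graphPair ⁻¹' S).toFinset)]
  · refine Finset.sum_congr rfl fun ω hω => ?_
    have h : graphPair ω ∈ S := by simpa using hω
    rw [oneIf_true h, mul_one, Measure.pi_singleton, ENNReal.ofReal_prod_of_nonneg fun e _ => hw _]
    exact Finset.prod_congr rfl fun e _ => pairLaw_singleton p s (ω e)
  · intro ω _ hω
    have h : graphPair ω ∉ S := by simpa using hω
    rw [oneIf_false h, mul_zero, ENNReal.ofReal_zero]

/-! ### From branching and acyclicity to the output of the algorithm. -/

namespace randomGraph

open SimpleGraph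

theorem inBoth_le_fst {n : ℕ} (ω : Sym2 (Fin n) → Bool × Bool) :
    randomGraph InBoth Set.univ ω ≤ (graphPair ω).1 := fun u v h => by
  simpa [graphPair] using And.intro h.2.2.2.1 h.1

theorem inBoth_le_snd {n : ℕ} (ω : Sym2 (Fin n) → Bool × Bool) :
    randomGraph InBoth Set.univ ω ≤ (graphPair ω).2 := fun u v h => by
  simpa [graphPair] using And.intro h.2.2.2.2 h.1

theorem fst_le_inEither {n : ℕ} (ω : Sym2 (Fin n) → Bool × Bool) :
    (graphPair ω).1 ≤ randomGraph InEither Set.univ ω := fun u v h => by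
  simp only [graphPair, fromEdgeSet_adj, Set.mem_ofPred_eq] at h
  exact ⟨h.2, trivial, trivial, Or.inl h.1⟩

theorem snd_le_inEither {n : ℕ} (ω : Sym2 (Fin n) → Bool × Bool) :
    (graphPair ω).2 ≤ randomGraph InEither Set.univ ω := fun u v h => by
  simp only [graphPair, fromEdgeSet_adj, Set.mem_ofPred_eq] at h
  exact ⟨h.2, trivial, trivial, Or.inr h.1⟩

theorem deleteIncidenceSet_univ {V α : Type*} (b : α → Prop) (ω : Sym2 V → α) (i : V) :
    (randomGraph b Set.univ ω).deleteIncidenceSet i = randomGraph b {i}ᶜ ω := by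
  ext u v
  rw [deleteIncidenceSet_adj]
  simp only [randomGraph, Set.mem_univ, Set.mem_compl_iff, Set.mem_singleton_iff]
  tauto

/-- The same neighbors `j`, `j'` of `i` in the intersection graph serve as witnesses on both sides.
Acyclicity passes from the union to both graphs, so the branches of the intersection are common
trees. -/
theorem mem_ntma {n N : ℕ} {γ : ℝ} {ω : Sym2 (Fin n) → Bool × Bool} {i : Fin n}
    (hY : Branching InBoth N (γ ^ N) i ω) (hc : excess InEither i (N + 1) ω < 1) :
    (i, i) ∈ ntma (graphPair ω).1 (graphPair ω).2 (N + 1) γ := by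
  have hU := noCycleInBall_of_excess_lt hc
  have h1 := hU.anti (fst_le_inEither ω)
  have h2 := hU.anti (snd_le_inEither ω)
  obtain ⟨j, j', hne, hji, hji', hb, hb', hg, hg'⟩ := hY
  have hadj {x : Fin n} (hx : x ≠ i) (hb : InBoth (ω s(i, x))) :
      (randomGraph InBoth Set.univ ω).Adj i x := ⟨hx.symm, trivial, trivial, hb⟩
  have hweight {x : Fin n} (hx : x ≠ i) (hb : InBoth (ω s(i, x)))
      (hg : γ ^ N < size InBoth {i}ᶜ x N ω) :
      γ ^ N < (edgeWeight (graphPair ω).1 (graphPair ω).2 N x i x i : ℝ) := by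
    have := card_sphere_le_edgeWeight (inBoth_le_fst ω) (inBoth_le_snd ω) (hadj hx hb) h1 h2
    rw [deleteIncidenceSet_univ] at this
    exact hg.trans_le (Nat.cast_le.2 this)
  exact ⟨h1, h2, j, inBoth_le_fst ω (hadj hji hb), j', inBoth_le_fst ω (hadj hji' hb'),
    j, inBoth_le_snd ω (hadj hji hb), j', inBoth_le_snd ω (hadj hji' hb'), hne, hne,
    hweight hji hb hg, hweight hji' hb' hg'⟩

theorem branching_sub_excess_le {n N : ℕ} (γ : ℝ) (ω : Sym2 (Fin n) → Bool × Bool) (i : Fin n) :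
    oneIf (Branching InBoth N (γ ^ N) i ω) - excess InEither i (N + 1) ω ≤
      (ntma (graphPair ω).1 (graphPair ω).2 (N + 1) γ).indicator (fun _ => (1 : ℝ)) (i, i) := by
  by_cases hY : Branching InBoth N (γ ^ N) i ω
  · by_cases hc : excess InEither i (N + 1) ω < 1
    · rw [Set.indicator_of_mem (mem_ntma hY hc), oneIf_true hY]
      linarith [excess_nonneg (b := InEither) (r := i) (N + 1) ω]
    · rw [oneIf_true hY]
      have : (0 : ℝ) ≤ (ntma (graphPair ω).1 (graphPair ω).2 (N + 1) γ).indicator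
        (fun _ => (1 : ℝ)) (i, i) := Set.indicator_nonneg (fun _ _ => zero_le_one) _
      linarith
  · rw [oneIf_false hY]
    have : (0 : ℝ) ≤ (ntma (graphPair ω).1 (graphPair ω).2 (N + 1) γ).indicator
        (fun _ => (1 : ℝ)) (i, i) := Set.indicator_nonneg (fun _ _ => zero_le_one) _
    linarith [excess_nonneg (b := InEither) (r := i) (N + 1) ω]

/-- The fraction of correctly matched nodes is at least `β / 4` with high probability. -/
theorem one_sub_le_mean_fraction {n N : ℕ} {lam s γ β : ℝ} (hn : 0 < n) (hlam : 0 ≤ lam)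
    (hs : s ∈ Set.Icc (0 : ℝ) 1) (hps : lam / n * (2 - s) ≤ 1) (hμ1 : 1 < lam * s)
    (hm1 : 1 < lam * (2 - s)) (hβ : 0 < β)
    (hY : ∀ i : Fin n, β ≤ productMean (markWeight (lam / n) s)
      fun ω => oneIf (Branching InBoth N (γ ^ N) i ω)) :
    1 - (32 / β ^ 2 * (lam * s / n * ((N + 1 : ℕ) ^ 2 *
          (lam * s / (lam * s - 1) * (lam * s) ^ (2 * (N + 1))))) +
        4 / β * (((N + 1 : ℕ) + 1) * (lam * (2 - s) / n * (1 + lam * (2 - s)) *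
          (lam * (2 - s) / (lam * (2 - s) - 1) * (lam * (2 - s)) ^ (2 * (N + 1)))))) ≤
      productMean (markWeight (lam / n) s) fun ω => oneIf (graphPair ω ∈
        {G : SimpleGraph (Fin n) × SimpleGraph (Fin n) | β / 4 ≤ (1 / (n : ℝ)) * ∑ i : Fin n,
            (ntma G.1 G.2 (N + 1) γ).indicator (fun _ => (1 : ℝ)) (i, i)}) := by
  have hn' : (0 : ℝ) < n := Nat.cast_pos.2 hn
  have hw := markWeight_nonneg (div_nonneg hlam hn'.le) hs hps
  have hw1 := sum_markWeight (lam / n) s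
  have hpH := sum_markWeight_inBoth (lam / n) s
  have hpU := sum_markWeight_inEither (lam / n) s
  have hμH : lam / n * s * Fintype.card (Fin n) = lam * s := by
    rw [Fintype.card_fin]; field_simp
  have hμU : lam / n * (2 - s) * Fintype.card (Fin n) = lam * (2 - s) := by
    rw [Fintype.card_fin]; field_simp
  set W := markWeight (lam / n) s
  set f : (Sym2 (Fin n) → Bool × Bool) → ℝ :=
    fun ω => ∑ i : Fin n, oneIf (Branching InBoth N (γ ^ N) i ω) with hf
  set h : (Sym2 (Fin n) → Bool × Bool) → ℝ :=
    fun ω => ∑ i : Fin n, excess InEither i (N + 1) ω with hh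
  set m := productMean W f with hm
  have hmβ : β * n ≤ m := by
    rw [hm, hf, productMean.sum]
    have := Finset.card_nsmul_le_sum Finset.univ _ β fun i _ => hY i
    rw [nsmul_eq_mul, Finset.card_univ, Fintype.card_fin] at this
    linarith
  set M := ((N + 1 : ℕ) : ℝ) ^ 2 * (lam * s / (lam * s - 1) * (lam * s) ^ (2 * (N + 1))) with hM
  have hM0 : 0 ≤ M := mul_nonneg (sq_nonneg _)
    (mul_nonneg (div_nonneg (by linarith) (by linarith)) (pow_nonneg (by linarith) _))
  have hvar : productMean W (fun ω => (f ω - m) ^ 2) ≤ 8 * (lam / n * s) * M * n ^ 2 := by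
    have := variance_sum_branching_le (k := N) hw hw1 hpH (γ ^ N)
      (fun x => mean_volume_sq_le hw hw1 hpH hμH hμ1 (le_refl (N + 1))) hM0
    rwa [Fintype.card_fin] at this
  have hexc : productMean W h ≤ n * (((N + 1 : ℕ) + 1) * (lam / n * (2 - s) *
      (1 + lam * (2 - s)) * (lam * (2 - s) / (lam * (2 - s) - 1) *
        (lam * (2 - s)) ^ (2 * (N + 1))))) := by
    rw [hh, productMean.sum]
    have := Finset.sum_le_card_nsmul Finset.univ _ _ fun (i : Fin n) _ =>
      mean_excess_le (r := i) hw hw1 hpU hμU hm1 (N + 1)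
    rw [nsmul_eq_mul, Finset.card_univ, Fintype.card_fin] at this
    exact this
  -- Markov and Chebyshev in pointwise form: a matched fraction below `β / 4` gives `f - h < β n /
  -- 4`. So either `h ≥ β n / 4`, or `f < β n / 2` although its mean is at least `β n`.
  have hpt (ω : Sym2 (Fin n) → Bool × Bool) :
      1 - (4 / (β * n) ^ 2 * (f ω - m) ^ 2 + 4 / (β * n) * h ω) ≤ oneIf (graphPair ω ∈
        {G : SimpleGraph (Fin n) × SimpleGraph (Fin n) | β / 4 ≤ (1 / (n : ℝ)) * ∑ i : Fin n,
            (ntma G.1 G.2 (N + 1) γ).indicator (fun _ => (1 : ℝ)) (i, i)}) := by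
    have hβn : 0 < β * n := mul_pos hβ hn'
    have hh0 : 0 ≤ h ω := Finset.sum_nonneg fun i _ => excess_nonneg _ _
    have t1 : 0 ≤ 4 / (β * n) ^ 2 * (f ω - m) ^ 2 := by positivity
    have t2 : 0 ≤ 4 / (β * n) * h ω := by positivity
    by_cases hS : graphPair ω ∈
        {G : SimpleGraph (Fin n) × SimpleGraph (Fin n) | β / 4 ≤ (1 / (n : ℝ)) * ∑ i : Fin n,
            (ntma G.1 G.2 (N + 1) γ).indicator (fun _ => (1 : ℝ)) (i, i)}
    · rw [oneIf_true hS]; linarith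
    · rw [oneIf_false hS]
      rw [Set.mem_ofPred_eq, not_le, one_div, inv_mul_lt_iff₀ hn'] at hS
      have hsum : f ω - h ω ≤ ∑ i : Fin n,
          (ntma (graphPair ω).1 (graphPair ω).2 (N + 1) γ).indicator (fun _ => (1 : ℝ)) (i, i) := by
        rw [hf, hh, ← Finset.sum_sub_distrib]
        exact Finset.sum_le_sum fun i _ => branching_sub_excess_le γ ω i
      rcases le_or_gt (β * n / 4) (h ω) with hbig | hsmall
      · have : 1 ≤ 4 / (β * n) * h ω := by
          rw [div_mul_eq_mul_div, le_div_iff₀ hβn]; linarith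
        linarith
      · have h1 : β * n / 2 ≤ m - f ω := by linarith
        have h2 := pow_le_pow_left₀ (by positivity) h1 2
        have : 1 ≤ 4 / (β * n) ^ 2 * (f ω - m) ^ 2 := by
          rw [div_mul_eq_mul_div, le_div_iff₀ (by positivity)]
          linarith
        linarith
  refine le_trans ?_ (productMean.mono hw hpt)
  rw [productMean.sub, productMean.const hw1, productMean.add, productMean.const_mul,
    productMean.const_mul]
  have e1 : 4 / (β * n) ^ 2 * (8 * (lam / n * s) * M * n ^ 2) =
      32 / β ^ 2 * (lam * s / n * M) := by
    field_simp; ring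
  have e2 : 4 / (β * n) * (n * (((N + 1 : ℕ) + 1) * (lam / n * (2 - s) *
      (1 + lam * (2 - s)) * (lam * (2 - s) / (lam * (2 - s) - 1) *
        (lam * (2 - s)) ^ (2 * (N + 1)))))) = 4 / β * (((N + 1 : ℕ) + 1) * (lam * (2 - s) / n *
        (1 + lam * (2 - s)) *
          (lam * (2 - s) / (lam * (2 - s) - 1) * (lam * (2 - s)) ^ (2 * (N + 1))))) := by
    have : lam * (2 - s) - 1 ≠ 0 := by linarith
    field_simp
  have h1 := mul_le_mul_of_nonneg_left hvar (show 0 ≤ 4 / (β * n) ^ 2 by positivity)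
  have h2 := mul_le_mul_of_nonneg_left hexc (show 0 ≤ 4 / (β * n) by positivity)
  rw [e1] at h1
  rw [e2] at h2
  linarith

/-- The probability that a node has two neighbors with many descendants is bounded from below. -/
theorem le_prob_branching_inBoth {n N : ℕ} {lam s γ : ℝ} (hn : 0 < n) (hlam : 0 ≤ lam)
    (hs : s ∈ Set.Icc (0 : ℝ) 1) (hps : lam / n * (2 - s) ≤ 1) (hμ1 : 1 < lam * s)
    (hγ0 : 0 ≤ γ) (hγ : 4 * γ ^ N ≤ (lam * s) ^ N)
    (hN : 2 * (lam * s / n * (2 + lam * s) * (N ^ 2 *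
      (lam * s / (lam * s - 1) * (lam * s) ^ (2 * N)))) ≤ lam * s - 1) (i : Fin n) :
    (lam * s / n) ^ 2 * (1 - lam * s / n) ^ n *
        (((n - 1) * ((lam * s - 1) / (16 * (lam * s)))) ^ 2 - n) / 2 ≤
      productMean (markWeight (lam / n) s) fun ω => oneIf (Branching InBoth N (γ ^ N) i ω) := by
  have hn' : (0 : ℝ) < n := Nat.cast_pos.2 hn
  have hw := markWeight_nonneg (div_nonneg hlam hn'.le) hs hps
  have hw1 := sum_markWeight (lam / n) s
  have hpH := sum_markWeight_inBoth (lam / n) s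
  rw [div_mul_eq_mul_div] at hpH
  have hμH : lam * s / n * Fintype.card (Fin n) = lam * s := by
    rw [Fintype.card_fin]; field_simp
  have hA : (Fintype.card (Fin n) : ℝ) - 1 ≤
      ∑ v : Fin n, oneIf (v ∈ ({i}ᶜ : Set (Fin n))) := by
    have h1 (v : Fin n) : oneIf (v ∈ ({i}ᶜ : Set (Fin n))) = 1 - if v = i then 1 else 0 := by
      by_cases h : v = i <;> simp [oneIf, h]
    simp only [h1, Finset.sum_sub_distrib, Finset.sum_ite_eq', Finset.mem_univ, if_true]
    simp
  have hq (j : Fin n) (hj : j ≠ i) := le_prob_lt_size (r := j) (A := {i}ᶜ) hw hw1 hpH hμH hμ1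
    hj hA hN (pow_nonneg hγ0 N) hγ
  have := le_prob_branching hw hw1 hpH (div_nonneg (by linarith) (by linarith)) i hq
  rw [Fintype.card_fin] at this
  linarith

end randomGraph

/-! ### Limits for depth `⌊c log n⌋`. -/

section Asymptotics

open Filter Topology

theorem tendsto_natFloor_mul_log_atTop {c : ℝ} (hc : 0 < c) :
    Tendsto (fun n : ℕ => ⌊c * Real.log n⌋₊) atTop atTop :=
  tendsto_nat_floor_atTop.comp
    ((Real.tendsto_log_atTop.comp tendsto_natCast_atTop_atTop).const_mul_atTop hc)

theorem tendsto_pow_mul_exp_neg_mul {δ : ℝ} (hδ : 0 < δ) (k : ℕ) :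
    Tendsto (fun y : ℝ => y ^ k * Real.exp (-(δ * y))) atTop (𝓝 0) := by
  have h := ((Real.tendsto_pow_mul_exp_neg_atTop_nhds_zero k).comp
    (tendsto_id.const_mul_atTop hδ)).const_mul ((δ ^ k)⁻¹)
  rw [mul_zero] at h
  refine h.congr fun y => ?_
  simp only [Function.comp, id, mul_pow]
  field_simp

/-- A tree of depth `⌊c log n⌋` and growth rate `μ` with `c log μ < 1 / 2` has far less than `√n`
vertices. -/
theorem tendsto_sq_mul_pow_div {c μ : ℝ} (hc : 0 < c) (hμ : 1 < μ) (h : c * Real.log μ < 1 / 2) :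
    Tendsto (fun n : ℕ => ((⌊c * Real.log n⌋₊ : ℝ) + 1) ^ 2 * μ ^ (2 * ⌊c * Real.log n⌋₊) / n)
      atTop (𝓝 0) := by
  have hδ : 0 < 1 - 2 * (c * Real.log μ) := by linarith
  -- Up to rounding the depth, `μ^(2d) / n` is `n^(-δ) = exp (-δ y)` with `y = log n`, which beats
  -- any power of `y`.
  set δ := 1 - 2 * (c * Real.log μ) with hδ_def
  have hlim : Tendsto (fun y : ℝ => (c * y + 1) ^ 2 * Real.exp (-(δ * y))) atTop (𝓝 0) := by
    have h2 := (tendsto_pow_mul_exp_neg_mul hδ 2).const_mul (c ^ 2)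
    have h1 := (tendsto_pow_mul_exp_neg_mul hδ 1).const_mul (2 * c)
    have h0 := tendsto_pow_mul_exp_neg_mul hδ 0
    have := (h2.add h1).add h0
    simp only [mul_zero, add_zero] at this
    exact this.congr fun y => by ring
  refine squeeze_zero' (Eventually.of_forall fun n => ?_) ?_
    (hlim.comp (Real.tendsto_log_atTop.comp tendsto_natCast_atTop_atTop))
  · have : 0 ≤ μ := by linarith
    positivity
  · filter_upwards [eventually_ge_atTop 1] with n hn
    have hn' : (0 : ℝ) < n := by exact_mod_cast hn
    have hlog : 0 ≤ Real.log n := Real.log_natCast_nonneg n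
    have hfl : (⌊c * Real.log n⌋₊ : ℝ) ≤ c * Real.log n := Nat.floor_le (by positivity)
    have hlμ : 0 < Real.log μ := Real.log_pos hμ
    simp only [Function.comp]
    rw [mul_div_assoc]
    refine mul_le_mul (pow_le_pow_left₀ (by positivity) (by linarith) 2) ?_
      (div_nonneg (pow_nonneg (by linarith) _) hn'.le) (sq_nonneg _)
    have e1 : μ ^ (2 * ⌊c * Real.log n⌋₊) =
        Real.exp (2 * ⌊c * Real.log n⌋₊ * Real.log μ) := by
      rw [← Real.exp_log (show 0 < μ by linarith), ← Real.exp_nat_mul, Real.log_exp]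
      push_cast
      rfl
    have e2 : (n : ℝ)⁻¹ = Real.exp (-Real.log n) := by
      rw [Real.exp_neg, Real.exp_log hn']
    rw [div_eq_mul_inv, e1, e2, ← Real.exp_add]
    refine Real.exp_le_exp.2 ?_
    have := mul_le_mul_of_nonneg_right hfl hlμ.le
    rw [hδ_def]
    linarith

/-- In the limit, `μ² e^(-μ) / 2` is the probability that a Poisson variable of mean `μ` equals `2`,
and `q²` stands for two large branches. -/
theorem tendsto_branching_bound (μ q : ℝ) :
    Tendsto (fun n : ℕ => (μ / n) ^ 2 * (1 - μ / n) ^ n * (((n - 1) * q) ^ 2 - n) / 2)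
      atTop (𝓝 (μ ^ 2 * Real.exp (-μ) * q ^ 2 / 2)) := by
  have h1 : Tendsto (fun n : ℕ => (1 + (-μ) / (n : ℝ)) ^ n) atTop (𝓝 (Real.exp (-μ))) :=
    Real.tendsto_one_add_div_pow_exp (-μ)
  have h2 : Tendsto (fun n : ℕ => 1 / (n : ℝ)) atTop (𝓝 0) := tendsto_one_div_atTop_nhds_zero_nat
  have h3 : Tendsto (fun n : ℕ => ((1 - 1 / (n : ℝ)) * q) ^ 2 - 1 / (n : ℝ)) atTop
      (𝓝 (((1 - 0) * q) ^ 2 - 0)) := (((tendsto_const_nhds.sub h2).mul_const q).pow 2).sub h2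
  have h4 := ((h1.mul h3).const_mul (μ ^ 2)).div_const 2
  rw [show μ ^ 2 * (Real.exp (-μ) * (((1 - 0) * q) ^ 2 - 0)) / 2 =
    μ ^ 2 * Real.exp (-μ) * q ^ 2 / 2 by ring] at h4
  refine h4.congr' ?_
  filter_upwards [eventually_ge_atTop 1] with n hn
  have hn' : (n : ℝ) ≠ 0 := by
    have : (0 : ℝ) < n := by exact_mod_cast hn
    exact this.ne'
  rw [show 1 + -μ / (n : ℝ) = 1 - μ / n by ring]
  field_simp

end Asymptotics

open randomGraph in
theorem mainTheorem4 (lam s c γ : ℝ) (hs : s ∈ Set.Icc (0 : ℝ) 1) (hlams : 1 < lam * s)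
    (hc : 0 < c) (hcd : c * Real.log (lam * (2 - s)) < 1 / 2)
    (hγ : γ ∈ Set.Ioo 1 (lam * s)) :
    ∃ α : ℝ, 0 < α ∧
      Filter.Tendsto
        (fun n : ℕ => ERC n (lam / n) s
          {G | α ≤ (1 / (n : ℝ)) * ∑ i : Fin n,
            (ntma G.1 G.2 ⌊c * Real.log n⌋₊ γ).indicator (fun _ => (1 : ℝ)) (i, i)})
        Filter.atTop (nhds 1) := by
  have hs0 : 0 < s := hs.1.lt_of_ne fun h => by rw [← h, mul_zero] at hlams; linarith
  have hlam : 0 < lam := by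
    by_contra hl
    linarith [mul_nonpos_of_nonpos_of_nonneg (not_lt.1 hl) hs.1]
  have hle : lam * s ≤ lam * (2 - s) := mul_le_mul_of_nonneg_left (by linarith [hs.2]) hlam.le
  have hm1 : 1 < lam * (2 - s) := hlams.trans_le hle
  -- The intersection graph grows no faster than the union, so the depth condition for the union
  -- covers both.
  have hcs : c * Real.log (lam * s) < 1 / 2 :=
    (mul_le_mul_of_nonneg_left (Real.log_le_log (by linarith) hle) hc.le).trans_lt hcd
  set μ := lam * s with hμ
  set m := lam * (2 - s) with hm
  set q := (μ - 1) / (16 * μ) with hq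
  have hμ0 : 0 < μ := by linarith
  have hq0 : 0 < q := div_pos (by linarith) (by linarith)
  -- Half of the limit in `tendsto_branching_bound`, so that the branching probability eventually
  -- exceeds it.
  set β := μ ^ 2 * Real.exp (-μ) * q ^ 2 / 4 with hβ_def
  have hβ : 0 < β := by positivity
  set Cμ := μ / (μ - 1) with hCμ
  set Cm := m / (m - 1) with hCm
  have hCμ0 : 0 < Cμ := div_pos hμ0 (by linarith)
  have hCm0 : 0 < Cm := div_pos (by linarith) (by linarith)
  have hm0 : 0 < m := by linarith
  set d : ℕ → ℕ := fun n => ⌊c * Real.log n⌋₊ with hd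
  set E : ℕ → ℝ := fun n => ((d n : ℝ) + 1) ^ 2 * μ ^ (2 * d n) / n with hE
  set E' : ℕ → ℝ := fun n => ((d n : ℝ) + 1) ^ 2 * m ^ (2 * d n) / n with hE'
  have tE : Filter.Tendsto E Filter.atTop (nhds 0) := tendsto_sq_mul_pow_div hc hlams hcs
  have tE' : Filter.Tendsto E' Filter.atTop (nhds 0) := tendsto_sq_mul_pow_div hc hm1 hcd
  set err : ℕ → ℝ := fun n => 32 / β ^ 2 * (μ * Cμ) * E n + 4 / β * (m * (1 + m) * Cm) * E' n
    with herr
  have terr : Filter.Tendsto (fun n => 1 - err n) Filter.atTop (nhds 1) := by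
    have := tendsto_const_nhds (x := (1 : ℝ)) |>.sub ((tE.const_mul (32 / β ^ 2 * (μ * Cμ))).add
      (tE'.const_mul (4 / β * (m * (1 + m) * Cm))))
    simpa using this
  have td := tendsto_natFloor_mul_log_atTop hc
  -- The room `γ < μ` absorbs the factor `4` required by the Paley–Zygmund step.
  have hgrow : ∀ᶠ n in Filter.atTop, 4 * γ ^ (d n - 1) ≤ μ ^ (d n - 1) := by
    have hγ0 : 0 < γ := by linarith [hγ.1]
    have h1 : Filter.Tendsto (fun n => (μ / γ) ^ (d n - 1)) Filter.atTop Filter.atTop :=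
      (tendsto_pow_atTop_atTop_of_one_lt ((one_lt_div hγ0).2 hγ.2)).comp
        ((Filter.tendsto_sub_atTop_nat 1).comp td)
    filter_upwards [h1.eventually_ge_atTop 4] with n hn
    rw [div_pow, le_div_iff₀ (pow_pos hγ0 _)] at hn
    exact hn
  have hsmall : ∀ᶠ n in Filter.atTop, 2 * ((2 + μ) * μ * Cμ) * E n < μ - 1 := by
    have := tE.const_mul (2 * ((2 + μ) * μ * Cμ))
    rw [mul_zero] at this
    exact this.eventually_lt_const (by linarith)
  have hbr : ∀ᶠ n : ℕ in Filter.atTop,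
      β < (μ / n) ^ 2 * (1 - μ / n) ^ n * (((n - 1) * q) ^ 2 - n) / 2 := by
    refine (tendsto_branching_bound μ q).eventually_const_lt ?_
    rw [hβ_def]
    have : 0 < μ ^ 2 * Real.exp (-μ) * q ^ 2 := by positivity
    linarith
  -- From this point on the weight `1 - p (2 - s)` is nonnegative and the model is a probability
  -- law.
  have hlarge : ∀ᶠ n : ℕ in Filter.atTop, m ≤ (n : ℝ) :=
    tendsto_natCast_atTop_atTop.eventually_ge_atTop m
  refine ⟨β / 4, by positivity, ?_⟩
  have hbounds : ∀ᶠ n : ℕ in Filter.atTop,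
      1 - err n ≤ productMean (markWeight (lam / n) s) (fun ω => oneIf (graphPair ω ∈
        {G : SimpleGraph (Fin n) × SimpleGraph (Fin n) | β / 4 ≤ (1 / (n : ℝ)) * ∑ i : Fin n,
          (ntma G.1 G.2 (d n) γ).indicator (fun _ => (1 : ℝ)) (i, i)})) := by
    filter_upwards [hgrow, hsmall, hbr, hlarge, Filter.eventually_gt_atTop 0,
      td.eventually_ge_atTop 1] with n hg hsm hb hml hn hd1
    have hn' : (0 : ℝ) < n := Nat.cast_pos.2 hn
    -- The depth is eventually positive, so the truncated `d n - 1` is a true predecessor: branches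
    -- are compared at depth `N`, balls have radius `N + 1`.
    obtain ⟨N, hN⟩ : ∃ N, d n = N + 1 := ⟨d n - 1, (Nat.sub_add_cancel hd1).symm⟩
    have hN' : d n - 1 = N := by omega
    rw [hN'] at hg
    have hps : lam / n * (2 - s) ≤ 1 := by
      rw [div_mul_eq_mul_div, div_le_one hn']; exact hml
    have hNE : 2 * (μ / n * (2 + μ) * (N ^ 2 * (Cμ * μ ^ (2 * N)))) ≤ μ - 1 := by
      refine le_trans ?_ hsm.le
      have h1 : (N : ℝ) ^ 2 * μ ^ (2 * N) ≤ ((d n : ℝ) + 1) ^ 2 * μ ^ (2 * d n) := by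
        have h2 : (N : ℝ) ≤ (d n : ℝ) + 1 := by rw [hN]; push_cast; linarith
        exact mul_le_mul (pow_le_pow_left₀ (Nat.cast_nonneg N) h2 2)
          (pow_le_pow_right₀ hlams.le (by omega)) (by positivity) (by positivity)
      have h3 := mul_le_mul_of_nonneg_left h1
        (show 0 ≤ 2 * ((2 + μ) * μ * Cμ) / n by positivity)
      calc 2 * (μ / n * (2 + μ) * (N ^ 2 * (Cμ * μ ^ (2 * N)))) =
            2 * ((2 + μ) * μ * Cμ) / n * (N ^ 2 * μ ^ (2 * N)) := by ring
        _ ≤ _ := h3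
        _ = 2 * ((2 + μ) * μ * Cμ) * E n := by rw [hE]; ring
    have hY := fun i => hb.le.trans (le_prob_branching_inBoth hn hlam.le hs hps hlams
      (by linarith [hγ.1]) hg hNE i)
    have := one_sub_le_mean_fraction hn hlam.le hs hps hlams hm1 hβ hY
    rw [← hN] at this
    refine le_trans ?_ this
    have h1 : μ / n * ((d n : ℕ) ^ 2 * (Cμ * μ ^ (2 * d n))) ≤ μ * Cμ * E n := by
      have : ((d n : ℕ) : ℝ) ^ 2 ≤ ((d n : ℝ) + 1) ^ 2 :=
        pow_le_pow_left₀ (Nat.cast_nonneg _) (by linarith) 2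
      have := mul_le_mul_of_nonneg_left this (show 0 ≤ μ * Cμ * μ ^ (2 * d n) / n by positivity)
      calc _ = μ * Cμ * μ ^ (2 * d n) / n * (d n : ℝ) ^ 2 := by ring
        _ ≤ _ := this
        _ = _ := by rw [hE]; ring
    have h2 : ((d n : ℕ) + 1) * (m / n * (1 + m) * (Cm * m ^ (2 * d n))) ≤
        m * (1 + m) * Cm * E' n := by
      have : (d n : ℝ) + 1 ≤ ((d n : ℝ) + 1) ^ 2 := by
        have : (0 : ℝ) ≤ d n := Nat.cast_nonneg _
        nlinarith
      have := mul_le_mul_of_nonneg_left this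
        (show 0 ≤ m * (1 + m) * Cm * m ^ (2 * d n) / n by positivity)
      calc _ = m * (1 + m) * Cm * m ^ (2 * d n) / n * ((d n : ℝ) + 1) := by ring
        _ ≤ _ := this
        _ = _ := by rw [hE']; ring
    have h3 := mul_le_mul_of_nonneg_left h1 (show 0 ≤ 32 / β ^ 2 by positivity)
    have h4 := mul_le_mul_of_nonneg_left h2 (show 0 ≤ 4 / β by positivity)
    simp only [herr]
    rw [mul_assoc (32 / β ^ 2), mul_assoc (4 / β)]
    linarith
  have hlim : Filter.Tendsto (fun n : ℕ => productMean (markWeight (lam / n) s)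
      (fun ω => oneIf (graphPair ω ∈
        {G : SimpleGraph (Fin n) × SimpleGraph (Fin n) | β / 4 ≤ (1 / (n : ℝ)) * ∑ i : Fin n,
          (ntma G.1 G.2 (d n) γ).indicator (fun _ => (1 : ℝ)) (i, i)})))
      Filter.atTop (nhds 1) := by
    refine tendsto_of_tendsto_of_tendsto_of_le_of_le' terr tendsto_const_nhds hbounds ?_
    filter_upwards [hlarge, Filter.eventually_gt_atTop 0] with n hml hn
    have hn' : (0 : ℝ) < n := Nat.cast_pos.2 hn
    have hps : lam / n * (2 - s) ≤ 1 := by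
      rw [div_mul_eq_mul_div, div_le_one hn']; exact hml
    refine (productMean.mono (markWeight_nonneg (by positivity) hs hps)
      fun ω => oneIf_le_one _).trans_eq (productMean.const (sum_markWeight _ _) 1)
  have hofReal := ENNReal.tendsto_ofReal hlim
  rw [ENNReal.ofReal_one] at hofReal
  refine hofReal.congr' ?_
  filter_upwards [hlarge, Filter.eventually_gt_atTop 0] with n hml hn
  have hn' : (0 : ℝ) < n := Nat.cast_pos.2 hn
  have hps : lam / n * (2 - s) ≤ 1 := by
    rw [div_mul_eq_mul_div, div_le_one hn']; exact hml
  rw [ERC_eq_ofReal (by positivity) hs hps]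
  rfl
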